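/- Let $S^1=\mathbb R/\mathbb Z$, let $Q\ge 1$ be an integer, and always write rational numbers as $p/q$ in reduced form with $q>0$. There is $\varepsilon_0>0$, depending only on $Q$, such that the following holds for every $0<\varepsilon<\varepsilon_0$, every $P\in\mathbb Z$ and all real numbers $X_1\le X_2$, neither of which is a rational number of denominator $\le Q$. *The map.* Let $\phi_0(x,y)=(x,y-x)$ on $[X_1,X_2]\times S^1$ with the area form $\omega=dx\wedge dy$, and let $\phi$ be a symplectomorphism obtained from $\phi_0$ by a Hamiltonian perturbation away from the boundary. Lift $\phi_0$ to $\tilde\phi_0(x,y)=(x,y-x)$, and $\phi$ to the map $\tilde\phi$ obtained from $\tilde\phi_0$ by lifting the Hamiltonian isotopy. Assume that $\tilde\phi=\tilde\phi_0$ whenever $x$ is not within distance $\varepsilon$ of a rational number of denominator $\le Q$; that for every $p/q\in[X_1,X_2]$ with $q\le Q$ there are periodic orbits $e_{p/q}$ and $h_{p/q}$ of $\phi$ of period $q$, each with a point within distance $\varepsilon$ of $\{x=p/q\}$, along which $\tilde\phi^{\,q}$ is the translation $y\mapsto y-p$; that these are the only irreducible periodic orbits of period $\le Q$; that the linearized return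 map of $e_{p/q}$ is elliptic with eigenvalues $e^{\pm2\pi i\theta}$, $0<\theta<1/Q$; and that the linearized return map of $h_{p/q}$ is hyperbolic with positive eigenvalues, different from $1$. *The almost complex structure.* Let $Y_\phi=[0,1]\times([X_1,X_2]\times S^1)/(1,z)\sim(0,\phi(z))$ be the mapping torus, with coordinate $t$ on $[0,1]$ and flow $R=\partial_t$, and let $s$ be the coordinate of $\mathbb R$ on $\mathbb R\times Y_\phi$. Let $J$ be any admissible almost complex structure on $\mathbb R\times Y_\phi$: $J$ is smooth, invariant under translations of $s$, $J(\partial_s)=R$, and $J$ is tamed by $\Omega=\omega+ds\wedge dt$, where $\omega$ is extended to $Y_\phi$ by $\omega(R,\cdot)=0$. *Generators and paths.* A generator is a commutative product $\alpha=\gamma_1\cdots\gamma_k$ of factors $\gamma_i\in\{e_{p_i/q_i},h_{p_i/q_i}\}$ with $p_i/q_i\in[X_1,X_2]$, in which no $h_{p/q}$ is repeated, and $\sum_i(p_i,q_i)=(P,Q)$. Order the factors so that $p_1/q_1\ge\dots\ge p_k/q_k$; then $\mathcal P(\alpha)$ is the path in the $(p,q)$-plane consisting of the segments from $w_{j-1}$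 to $w_j$, $1\le j\le k$, where $w_j=\sum_{i\le j}(p_i,q_i)$. For generators $\alpha,\beta$, say that $\mathcal P(\alpha)$ crosses to the right of $\mathcal P(\beta)$ if there are $(a,b)\in\mathcal P(\alpha)$ and $(a',b)\in\mathcal P(\beta)$ with $a>a'$. *Flow lines.* A flow line from $\alpha$ to $\beta$ is a $J$-holomorphic curve $C$ in $\mathbb R\times Y_\phi$, parametrized by a compact (not necessarily connected) Riemann surface minus finitely many points, such that: $C$ is embedded, except that trivial cylinders $\mathbb R\times\gamma$ over periodic orbits $\gamma$ may be repeated but may not meet the rest of $C$; and every puncture is either an outgoing end (as $s\to+\infty$, asymptotic to a connected $m$-fold cover of some $e_{p/q}$ or $h_{p/q}$, $m\ge1$ being the multiplicity of the end) or an incoming end (the same as $s\to-\infty$), where for each orbit $\gamma$ the multiplicities of the outgoing ends at $\gamma$ add up to the exponent of $\gamma$ in $\alpha$, and those of the incoming ends at $\gamma$ to its exponent in $\beta$. **Claim.** If $\alpha$ and $\beta$ are generators such that $\mathcal P(\alpha)$ crosses to the right of $\mathcal P(\beta)$, then there are no flow lines from $\alpha$ to $\beta$. -/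

import Mathlib

open Set Filter Topology
open scoped Manifold ContDiff

/-! ### The twist, its perturbations and their periodic orbits

Maps of the cylinder `[X₁,X₂] × ℝ/ℤ` are written through lifts to `ℝ × ℝ` that commute with
`(x,y) ↦ (x,y+1)`.  A map that agrees with the twist near the boundary is continued by the twist
to all `x ∈ ℝ`; only the part over `[X₁,X₂]` is used. -/

namespace CylTwist

/-- The lift of the twist `(x,y) ↦ (x, y - x)`. -/
def twist (z : ℝ × ℝ) : ℝ × ℝ := (z.1, z.2 - z.1)

/-- The Hamiltonian vector field `(∂H/∂y, -∂H/∂x)` of `H(τ,·)` for the area form `dx ∧ dy`. -/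
noncomputable def hamVF (H : ℝ × (ℝ × ℝ) → ℝ) (τ : ℝ) (z : ℝ × ℝ) : ℝ × ℝ :=
  (fderiv ℝ H (τ, z) (0, (0, 1)), -fderiv ℝ H (τ, z) (0, (1, 0)))

/-- `φ` is the twist preceded by the time-one map `ψ 1` of a time-dependent Hamiltonian flow on the
cylinder whose vector field vanishes near the boundary of `[X₁,X₂] × ℝ/ℤ`.  The lift of the flow is
the one starting at the identity. -/
def IsHamiltonianPerturbation (X₁ X₂ : ℝ) (φ : ℝ × ℝ → ℝ × ℝ) : Prop :=
  ∃ (H : ℝ × (ℝ × ℝ) → ℝ) (ψ : ℝ → ℝ × ℝ → ℝ × ℝ),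
    ContDiff ℝ ∞ H ∧
    (∀ τ x y, H (τ, (x, y + 1)) = H (τ, (x, y))) ∧
    (∃ δ > 0, ∀ τ z, (z.1 ≤ X₁ + δ ∨ X₂ - δ ≤ z.1) → hamVF H τ z = 0) ∧
    (∀ z, ψ 0 z = z) ∧
    (∀ z, ∀ τ ∈ Icc (0 : ℝ) 1, HasDerivAt (fun τ' => ψ τ' z) (hamVF H τ (ψ τ z)) τ) ∧
    ∀ z, φ z = twist (ψ 1 z)

/-- The two families of periodic orbits `e_{p/q}` and `h_{p/q}`. -/
inductive Kind
  | e
  | h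
  deriving DecidableEq

/-- The label `(e, p/q)` stands for `e_{p/q}` and `(h, p/q)` for `h_{p/q}`.  A rational number is
in reduced form with positive denominator. -/
abbrev OrbitLabel : Type := Kind × ℚ

/-- The eigenvalues are `exp (± 2πiθ)`, not real, with `0 < θ < 1/Q`. -/
def IsSmallElliptic (Q : ℕ) (A : (ℝ × ℝ) →L[ℝ] (ℝ × ℝ)) : Prop :=
  ∃ θ : ℝ, 0 < θ ∧ θ < 1 / Q ∧ 2 * θ ≠ 1 ∧
    ((LinearMap.charpoly (A : (ℝ × ℝ) →ₗ[ℝ] (ℝ × ℝ))).map (algebraMap ℝ ℂ)).roots =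
      {Complex.exp (2 * Real.pi * θ * Complex.I), Complex.exp (-(2 * Real.pi * θ * Complex.I))}

/-- The eigenvalues are real, positive and different from `1` (they are inverse to each other,
since the return map preserves area). -/
def IsPosHyperbolic (A : (ℝ × ℝ) →L[ℝ] (ℝ × ℝ)) : Prop :=
  ∃ c : ℝ, 0 < c ∧ c ≠ 1 ∧
    (LinearMap.charpoly (A : (ℝ × ℝ) →ₗ[ℝ] (ℝ × ℝ))).roots = {c, c⁻¹}

/-- The perturbed twist `φ` (through its lift), together with a point of each of the periodic
orbits `e_{p/q}` and `h_{p/q}` with `p/q ∈ [X₁,X₂]` and `q ≤ Q` (the values of `pt` at other labels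
play no role). -/
structure PerturbedTwist (Q : ℕ) (X₁ X₂ ε : ℝ) where
  φ : Equiv.Perm (ℝ × ℝ)
  map_shift : ∀ z, φ (z + (0, 1)) = φ z + (0, 1)
  smooth : ContDiff ℝ ∞ φ
  smooth_symm : ContDiff ℝ ∞ φ.symm
  symplectic : ∀ z, (fderiv ℝ φ z).det = 1
  hamiltonian : IsHamiltonianPerturbation X₁ X₂ φ
  near_boundary : ∃ δ > 0, ∀ z : ℝ × ℝ, (z.1 ≤ X₁ + δ ∨ X₂ - δ ≤ z.1) → φ z = twist z
  /-- `φ` is the twist outside the `ε`-neighbourhoods of the rationals of denominator `≤ Q`. -/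
  agrees : ∀ z : ℝ × ℝ, (∀ r : ℚ, r.den ≤ Q → ε < |z.1 - r|) → φ z = twist z
  pt : OrbitLabel → ℝ × ℝ
  pt_mem : ∀ (k : Kind) (r : ℚ), (r : ℝ) ∈ Icc X₁ X₂ → r.den ≤ Q →
    (pt (k, r)).1 ∈ Icc X₁ X₂
  /-- The orbits labelled `p/q` arise from the circle at `x = p/q`: they stay close to it, ... -/
  pt_near : ∀ (k : Kind) (r : ℚ), (r : ℝ) ∈ Icc X₁ X₂ → r.den ≤ Q → |(pt (k, r)).1 - r| ≤ ε
  /-- ... have period `q`, and turn around the cylinder `-p` times, as that circle does.  (The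
  least period is `q` because `p` and `q` are coprime.) -/
  pt_periodic : ∀ (k : Kind) (r : ℚ), (r : ℝ) ∈ Icc X₁ X₂ → r.den ≤ Q →
    φ^[r.den] (pt (k, r)) = pt (k, r) - (0, (r.num : ℝ))
  elliptic : ∀ r : ℚ, (r : ℝ) ∈ Icc X₁ X₂ → r.den ≤ Q →
    IsSmallElliptic Q (fderiv ℝ (φ^[r.den]) (pt (.e, r)))
  hyperbolic : ∀ r : ℚ, (r : ℝ) ∈ Icc X₁ X₂ → r.den ≤ Q →
    IsPosHyperbolic (fderiv ℝ (φ^[r.den]) (pt (.h, r)))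
  /-- There are no further periodic orbits of period `≤ Q` in the cylinder. -/
  only_orbits : ∀ (z : ℝ × ℝ) (n : ℕ) (m : ℤ), z.1 ∈ Icc X₁ X₂ → 0 < n → n ≤ Q →
    φ^[n] z = z + (0, (m : ℝ)) →
    ∃ (k : Kind) (r : ℚ) (j : ℕ) (l : ℤ), (r : ℝ) ∈ Icc X₁ X₂ ∧ r.den ≤ Q ∧
      z = φ^[j] (pt (k, r)) + (0, (l : ℝ))

/-! ### Generators and polygonal paths -/

/-- A generator of the complex for `(X₁,X₂;P,Q)`: a commutative product (multiset) of `e_{p/q}` and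
`h_{p/q}` with `p/q ∈ [X₁,X₂]`, without repeated `h_{p/q}`, of total numerator `P` and total
denominator `Q`. -/
structure IsGenerator (X₁ X₂ : ℝ) (P : ℤ) (Q : ℕ) (α : Multiset OrbitLabel) : Prop where
  mem_Icc : ∀ γ ∈ α, (γ.2 : ℝ) ∈ Icc X₁ X₂
  admissible : ∀ r : ℚ, α.count (.h, r) ≤ 1
  sum_num : (α.map fun γ => γ.2.num).sum = P
  sum_den : (α.map fun γ => γ.2.den).sum = Q

/-- The rational numbers of the factors, in decreasing order. -/
def slopes (α : Multiset OrbitLabel) : List ℚ := (α.map Prod.snd).sort (· ≥ ·)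

/-- The vertex `w_j`: the sum of the first `j` vectors `(p,q)`. -/
noncomputable def vertex (α : Multiset OrbitLabel) (j : ℕ) : ℝ × ℝ :=
  (((slopes α).take j).map fun r => ((r.num : ℝ), (r.den : ℝ))).sum

/-- The polygonal path `𝒫(α)` in the `(p,q)`-plane, as a point set. -/
def polyPath (α : Multiset OrbitLabel) : Set (ℝ × ℝ) :=
  {w | ∃ j < (slopes α).length, w ∈ segment ℝ (vertex α j) (vertex α (j + 1))}

/-- `𝒫(α)` crosses to the right of `𝒫(β)`: some point of `𝒫(α)` lies strictly to the right of a
point of `𝒫(β)` at the same height `q`.  (Both paths are strictly increasing in `q`.) -/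
def CrossesRight (α β : Multiset OrbitLabel) : Prop :=
  ∃ a ∈ polyPath α, ∃ b ∈ polyPath β, a.2 = b.2 ∧ b.1 < a.1

/-! ### The mapping torus -/

variable {Q : ℕ} {X₁ X₂ ε : ℝ}

/-- The cover `ℝ_t × ([X₁,X₂] × ℝ)` of the mapping torus. -/
abbrev Cov (X₁ X₂ : ℝ) : Type := ℝ × {z : ℝ × ℝ // z.1 ∈ Icc X₁ X₂}

theorem map_shift_int (F : PerturbedTwist Q X₁ X₂ ε) (k : ℤ) (z : ℝ × ℝ) :
    F.φ (z + (0, (k : ℝ))) = F.φ z + (0, (k : ℝ)) := by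
  have hnat : ∀ (n : ℕ) (z : ℝ × ℝ), F.φ (z + (0, (n : ℝ))) = F.φ z + (0, (n : ℝ)) := by
    intro n
    induction n with
    | zero =>
      intro z
      have h0 : ((0, ((0 : ℕ) : ℝ)) : ℝ × ℝ) = 0 := by ext <;> simp
      rw [h0, add_zero, add_zero]
    | succ n ih =>
      intro z
      have h1 : z + (0, ((n + 1 : ℕ) : ℝ)) = (z + (0, (n : ℝ))) + (0, 1) := by
        ext <;> simp [add_assoc]
      rw [h1, F.map_shift, ih]
      ext <;> simp [add_assoc]
  obtain ⟨n, rfl | rfl⟩ := k.eq_nat_or_neg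
  · simpa using hnat n z
  · have h := hnat n (z + (0, ((-(n : ℤ) : ℤ) : ℝ)))
    have h2 : z + (0, ((-(n : ℤ) : ℤ) : ℝ)) + (0, (n : ℝ)) = z := by ext <;> simp
    rw [h2] at h
    rw [h]
    ext <;> simp

theorem zpow_shift_int (F : PerturbedTwist Q X₁ X₂ ε) (n k : ℤ) (z : ℝ × ℝ) :
    (F.φ ^ n) (z + (0, (k : ℝ))) = (F.φ ^ n) z + (0, (k : ℝ)) := by
  have hinv : ∀ z : ℝ × ℝ, F.φ⁻¹ (z + (0, (k : ℝ))) = F.φ⁻¹ z + (0, (k : ℝ)) := by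
    intro z
    rw [Equiv.Perm.inv_eq_iff_eq, map_shift_int]
    simp
  induction n generalizing z with
  | zero => simp
  | succ n ih => rw [zpow_add_one, Equiv.Perm.mul_apply, map_shift_int, ih]; rfl
  | pred n ih => rw [zpow_sub_one, Equiv.Perm.mul_apply, hinv, ih]; rfl

/-- The equivalence relation on the cover generated by `(t, z) ~ (t - 1, φ z)`, that is
`(1, z) ~ (0, φ z)`, and by `y ↦ y + 1`. -/
def torusSetoid (F : PerturbedTwist Q X₁ X₂ ε) : Setoid (Cov X₁ X₂) where
  r a b := ∃ n k : ℤ, b.1 = a.1 - n ∧ (b.2 : ℝ × ℝ) = (F.φ ^ n) (a.2 : ℝ × ℝ) + (0, (k : ℝ))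
  iseqv :=
    { refl := fun a => ⟨0, 0, by simp, by ext <;> simp⟩
      symm := by
        rintro a b ⟨n, k, h1, h2⟩
        refine ⟨-n, -k, by rw [h1]; push_cast; ring, ?_⟩
        have h3 : (F.φ ^ (-n)) ((F.φ ^ n) (a.2 : ℝ × ℝ)) = a.2 := by
          rw [← Equiv.Perm.mul_apply, ← zpow_add, neg_add_cancel, zpow_zero]
          rfl
        rw [h2, zpow_shift_int, h3]
        ext <;> simp
      trans := by
        rintro a b c ⟨n, k, h1, h2⟩ ⟨n', k', h1', h2'⟩
        refine ⟨n' + n, k + k', by rw [h1', h1]; push_cast; ring, ?_⟩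
        rw [h2', h2, zpow_shift_int, zpow_add, Equiv.Perm.mul_apply]
        ext <;> simp [add_assoc] }

/-- The mapping torus `Y_φ`, with the quotient topology. -/
def MappingTorus (F : PerturbedTwist Q X₁ X₂ ε) : Type := Quotient (torusSetoid F)

instance (F : PerturbedTwist Q X₁ X₂ ε) : TopologicalSpace (MappingTorus F) :=
  inferInstanceAs (TopologicalSpace (Quotient (torusSetoid F)))

/-- The covering map onto `Y_φ`. -/
def proj (F : PerturbedTwist Q X₁ X₂ ε) (a : Cov X₁ X₂) : MappingTorus F :=
  Quotient.mk (torusSetoid F) a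

/-- The orbit of the suspension flow `R = ∂/∂t` through `(0, z)`. -/
def flowOrbit (F : PerturbedTwist Q X₁ X₂ ε) (z : {z : ℝ × ℝ // z.1 ∈ Icc X₁ X₂}) :
    Set (MappingTorus F) :=
  range fun t : ℝ => proj F (t, z)

/-- `z` lies on a periodic orbit of the cylinder map. -/
def IsPeriodicPt (F : PerturbedTwist Q X₁ X₂ ε) (z : ℝ × ℝ) : Prop :=
  ∃ (n : ℕ) (m : ℤ), 0 < n ∧ F.φ^[n] z = z + (0, (m : ℝ))

/-! ### Almost complex structures -/

/-- The tangent space of `ℝ × Y_φ`, in coordinates `(s, t, (x, y))` of the cover. -/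
abbrev Tan : Type := ℝ × ℝ × (ℝ × ℝ)

/-- The two-form `Ω = ω + ds ∧ dt`, where `ω = dx ∧ dy`. -/
def Omega (v w : Tan) : ℝ :=
  (v.2.2.1 * w.2.2.2 - v.2.2.2 * w.2.2.1) + (v.1 * w.2.1 - v.2.1 * w.1)

/-- The differential at `(s, t, z)` of the deck transformation `(s, t, z) ↦ (s, t - 1, φ z)`. -/
noncomputable def deckDiff (F : PerturbedTwist Q X₁ X₂ ε) (z : ℝ × ℝ) (v : Tan) : Tan :=
  (v.1, v.2.1, fderiv ℝ F.φ z v.2.2)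

/-- An admissible almost complex structure on `ℝ × Y_φ`: a smooth almost complex structure on the
cover, independent of `s` (invariance under the `ℝ`-action), invariant under the deck
transformations, sending `∂/∂s` to `R = ∂/∂t`, and tamed by `Ω`. -/
structure AdmissibleJ (F : PerturbedTwist Q X₁ X₂ ε) where
  J : ℝ × (ℝ × ℝ) → (Tan →L[ℝ] Tan)
  smooth : ContDiffOn ℝ ∞ J {a | a.2.1 ∈ Icc X₁ X₂}
  sq : ∀ a, a.2.1 ∈ Icc X₁ X₂ → ∀ v, J a (J a v) = -v
  inv_shift : ∀ (t : ℝ) (z : ℝ × ℝ), z.1 ∈ Icc X₁ X₂ → J (t, z + (0, 1)) = J (t, z)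
  inv_deck : ∀ (t : ℝ) (z : ℝ × ℝ), z.1 ∈ Icc X₁ X₂ → ∀ v,
    J (t - 1, F.φ z) (deckDiff F z v) = deckDiff F z (J (t, z) v)
  map_s : ∀ a, a.2.1 ∈ Icc X₁ X₂ → J a (1, 0, 0) = (0, 1, 0)
  tamed : ∀ a, a.2.1 ∈ Icc X₁ X₂ → ∀ v, v ≠ 0 → 0 < Omega v (J a v)

/-! ### Pseudoholomorphic curves and flow lines -/

section Curves

variable {S : Type*} [TopologicalSpace S] [ChartedSpace ℂ S]

/-- A point of `ℝ × (cover of Y_φ)` as a vector `(s, t, (x, y))`. -/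
def toTan (a : ℝ × Cov X₁ X₂) : Tan := (a.1, a.2.1, (a.2.2 : ℝ × ℝ))

/-- Near `z₀`, in the complex coordinate of the chart at `z₀`, the map `f` is a smooth lift of
`u : S → ℝ × Y_φ` to the cover and satisfies the Cauchy-Riemann equation `df ∘ i = J ∘ df`. -/
def IsHolomorphicLift (F : PerturbedTwist Q X₁ X₂ ε) (J : AdmissibleJ F)
    (u : S → ℝ × MappingTorus F) (z₀ : S) (f : ℂ → ℝ × Cov X₁ X₂) : Prop :=
  ContDiffAt ℝ ∞ (fun w => toTan (f w)) (chartAt ℂ z₀ z₀) ∧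
  ∀ᶠ w in 𝓝 (chartAt ℂ z₀ z₀),
    ((f w).1, proj F (f w).2) = u ((chartAt ℂ z₀).symm w) ∧
    ∀ v : ℂ, fderiv ℝ (fun w' => toTan (f w')) w (Complex.I * v) =
      J.J ((f w).2.1, ((f w).2.2 : ℝ × ℝ)) (fderiv ℝ (fun w' => toTan (f w')) w v)

/-- `u` is `J`-holomorphic near `z₀`. -/
def IsHolomorphicAt (F : PerturbedTwist Q X₁ X₂ ε) (J : AdmissibleJ F)
    (u : S → ℝ × MappingTorus F) (z₀ : S) : Prop :=
  ∃ f, IsHolomorphicLift F J u z₀ f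

/-- The `J`-holomorphic map `u` has injective differential at `z₀`. -/
def IsImmersedAt (F : PerturbedTwist Q X₁ X₂ ε) (J : AdmissibleJ F)
    (u : S → ℝ × MappingTorus F) (z₀ : S) : Prop :=
  ∃ f, IsHolomorphicLift F J u z₀ f ∧
    Function.Injective (fderiv ℝ (fun w => toTan (f w)) (chartAt ℂ z₀ z₀))

/-- The point with cylindrical coordinates `(σ, τ)` around `ζ`: its complex coordinate relative to
`ζ` is `exp (-2π(σ + iτ))`, so that `σ → ∞` is the approach to `ζ`. -/
noncomputable def endCoord (ζ : S) (c : ℝ × ℝ) : S :=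
  (chartAt ℂ ζ).symm (chartAt ℂ ζ ζ +
    Complex.exp (-(2 * Real.pi * ((c.1 : ℂ) + (c.2 : ℂ) * Complex.I))))

/-- The puncture `ζ` is an end of `u` asymptotic to a half-cylinder over a cover of the closed
orbit through `(0, z)`: near `ζ` the coordinate `s` tends to the end `l` of `ℝ`, and the projection
to `Y_φ` has a continuous lift `g` in cylindrical coordinates that converges to the line
`t ↦ (t, z)`, uniformly on one period, and whose `t`-coordinate increases by `N` when `ζ` is
encircled once in the positive direction of `τ`. -/
def IsEnd (F : PerturbedTwist Q X₁ X₂ ε) (u : S → ℝ × MappingTorus F) (ζ : S)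
    (l : Filter ℝ) (N : ℤ) (z : ℝ × ℝ) : Prop :=
  Tendsto (fun p => (u p).1) (𝓝[≠] ζ) l ∧
  ∃ (σ₀ : ℝ) (g : ℝ × ℝ → Cov X₁ X₂), ContinuousOn g {c | σ₀ < c.1} ∧
    (∀ c : ℝ × ℝ, σ₀ < c.1 → proj F (g c) = (u (endCoord ζ c)).2) ∧
    (∀ σ τ : ℝ, σ₀ < σ → (g (σ, τ + 1)).1 = (g (σ, τ)).1 + N) ∧
    ∀ δ > 0, ∃ σ₁, ∀ σ > σ₁, ∀ τ ∈ Icc (0 : ℝ) 1, dist ((g (σ, τ)).2 : ℝ × ℝ) z < δ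

/-- An outgoing end of multiplicity `m` at the orbit `γ` (whose period is the denominator). -/
def IsOutgoingEnd (F : PerturbedTwist Q X₁ X₂ ε) (u : S → ℝ × MappingTorus F) (ζ : S)
    (γ : OrbitLabel) (m : ℕ) : Prop :=
  IsEnd F u ζ atTop ((m : ℤ) * γ.2.den) (F.pt γ)

/-- An incoming end of multiplicity `m` at the orbit `γ`.  Since `s → -∞`, the curve runs through
the orbit in the positive sense as `τ` decreases. -/
def IsIncomingEnd (F : PerturbedTwist Q X₁ X₂ ε) (u : S → ℝ × MappingTorus F) (ζ : S)
    (γ : OrbitLabel) (m : ℕ) : Prop :=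
  IsEnd F u ζ atBot (-((m : ℤ) * γ.2.den)) (F.pt γ)

/-- A flow line from `α` to `β`, parametrized by the compact Riemann surface `S` minus finitely many
punctures.  (The values of `u` at the punctures play no role.) -/
structure FlowLine (F : PerturbedTwist Q X₁ X₂ ε) (J : AdmissibleJ F)
    (α β : Multiset OrbitLabel) (S : Type*) [TopologicalSpace S] [ChartedSpace ℂ S] where
  /-- the outgoing and the incoming punctures -/
  out : Finset S
  inc : Finset S
  disj : Disjoint out inc
  u : S → ℝ × MappingTorus F
  holo : ∀ z, z ∉ out → z ∉ inc → IsHolomorphicAt F J u z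
  /-- the orbit and the multiplicity of each end -/
  orbit : S → OrbitLabel
  mult : S → ℕ
  mult_pos : ∀ ζ, ζ ∈ out ∨ ζ ∈ inc → 0 < mult ζ
  out_end : ∀ ζ ∈ out, IsOutgoingEnd F u ζ (orbit ζ) (mult ζ)
  inc_end : ∀ ζ ∈ inc, IsIncomingEnd F u ζ (orbit ζ) (mult ζ)
  out_total : ∀ γ, ∑ ζ ∈ out with orbit ζ = γ, mult ζ = α.count γ
  inc_total : ∀ γ, ∑ ζ ∈ inc with orbit ζ = γ, mult ζ = β.count γ
  /-- a union of components of `S`, each of which parametrizes a trivial cylinder (repetitions are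
  allowed) -/
  triv : Set S
  triv_clopen : IsClopen triv
  triv_cylinder : ∀ z ∈ triv, ∃ y : {y : ℝ × ℝ // y.1 ∈ Icc X₁ X₂}, IsPeriodicPt F y ∧
    BijOn u (connectedComponent z \ (out ∪ inc)) (univ ×ˢ flowOrbit F y)
  /-- the rest of the curve is embedded ... -/
  immersed : ∀ z, z ∉ out → z ∉ inc → z ∉ triv → IsImmersedAt F J u z
  embedded : IsEmbedding (Set.domRestrict {z | z ∉ out ∧ z ∉ inc ∧ z ∉ triv} u)
  /-- ... and disjoint from the trivial cylinders in `triv` -/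
  triv_disj : Disjoint (u '' {z | z ∉ out ∧ z ∉ inc ∧ z ∈ triv})
    (u '' {z | z ∉ out ∧ z ∉ inc ∧ z ∉ triv})

end Curves

end CylTwist

/-! Suppose a flow line `C` from `α` to `β` exists. The proof measures the area that `C` sweeps out
in one thin strip `a ≤ x ≤ b` lying just to the right of a rational `r` and outside all
`ε`-neighbourhoods. Over the strip the map is the twist, so the circles `x = const` are invariant
and the two sides of the strip are never exchanged. A function of `x` that is constant on each side
therefore descends to `Y_φ`.

Let `G` rise from `-1` to `0` across the strip. The form `G'(x) dx ∧ dy` is nonnegative on `C`,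
because `J` is tamed and preserves the plane spanned by `∂/∂s` and `R`. On the strip it equals `dG ∧
dY + dK ∧ dT`, where `T` is a smoothed flow coordinate, `Y = y - T x`, and `K' = x G'`. Here `T` and
`Y` are well defined on `Y_φ` modulo integers, so Stokes' theorem on the punctured surface
(`flux_eq_sum`) turns the integral into a sum over the ends of `G` times the winding of `Y` plus `K`
times the winding of `T`. An end of multiplicity `m` at an orbit labelled `p/q` has windings `∓mp`
and `±mq`. It contributes `±m(p - cq)` if it lies to the left of the strip and `0` if it lies to the
right, where `c ∈ [a,b]` is the average of `x` for the density `G'`. Hence the sum of `p - cq` over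
the factors left of the strip is at least as large for `α` as for `β` (`FlowLine.exists_flux_le`).

The rest is convex geometry. The sum of the positive parts of `p - rq` is the support function of
the path in the direction `(1,-r)`. If `𝒫(α)` crosses to the right of `𝒫(β)`, the support function
of `α` exceeds that of `β` at the slope `r` of some edge of `𝒫(β)`, and integrality makes the excess
at least `1/q` for `q` the denominator of `r` (`CrossesRight.exists_supportVal_gap`). Since both
paths have the same endpoint, the flux inequality bounds the excess by `2εQ`, which is too small. -/

namespace SurfaceFlux

/-! ### Planar calculus of the form `df ∧ d(arg E)`. -/

open MeasureTheory ComplexConjugate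

/-- The angular derivative `d(arg E) / 2π` of a circle-valued function. -/
noncomputable def angDeriv (E : ℂ → ℂ) (w v : ℂ) : ℝ :=
  (conj (E w) * fderiv ℝ E w v).im / (2 * Real.pi)

/-- The density of `df ∧ d(arg E) / 2π`. -/
noncomputable def jac (f : ℂ → ℝ) (E : ℂ → ℂ) (w : ℂ) : ℝ :=
  fderiv ℝ f w 1 * angDeriv E w Complex.I - fderiv ℝ f w Complex.I * angDeriv E w 1

theorem realLinear_apply_eq {V : Type*} [AddCommGroup V] [Module ℝ V] [TopologicalSpace V]
    (A : ℂ →L[ℝ] V) (c : ℂ) : A c = c.re • A 1 + c.im • A Complex.I := by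
  conv_lhs => rw [← Complex.re_add_im c]
  have h1 : ((c.re : ℂ)) = c.re • (1 : ℂ) := by simp
  have h2 : ((c.im : ℂ)) * Complex.I = c.im • Complex.I := by simp
  rw [h1, h2, map_add, map_smul, map_smul]

theorem angDeriv_eq (E : ℂ → ℂ) (w c : ℂ) :
    angDeriv E w c = c.re * angDeriv E w 1 + c.im * angDeriv E w Complex.I := by
  unfold angDeriv
  rw [realLinear_apply_eq (fderiv ℝ E w) c]
  simp only [mul_add, Complex.real_smul, Complex.add_im, Complex.mul_im, Complex.mul_re,
    Complex.ofReal_re, Complex.ofReal_im]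
  ring

/-- Invariance of the density under rotation of the frame. -/
theorem jac_eq_frame (f : ℂ → ℝ) (E : ℂ → ℂ) (w c : ℂ) :
    fderiv ℝ f w c * angDeriv E w (c * Complex.I) -
      fderiv ℝ f w (c * Complex.I) * angDeriv E w c = ‖c‖ ^ 2 * jac f E w := by
  rw [angDeriv_eq E w c, angDeriv_eq E w (c * Complex.I), realLinear_apply_eq (fderiv ℝ f w) c,
    realLinear_apply_eq (fderiv ℝ f w) (c * Complex.I), ← Complex.normSq_eq_norm_sq,
    Complex.normSq_apply]
  simp [jac]
  ring

/-- The real differential of `T` is multiplication by `c`, so the frame `1, i` goes to `c, ci` and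
`jac_eq_frame` applies. The factor is the Jacobian determinant of `T`, which makes the density a
two-form. -/
theorem jac_comp {f : ℂ → ℝ} {E T : ℂ → ℂ} {w c : ℂ} (hT : HasDerivAt T c w)
    (hf : DifferentiableAt ℝ f (T w)) (hE : DifferentiableAt ℝ E (T w)) :
    jac (f ∘ T) (E ∘ T) w = ‖c‖ ^ 2 * jac f E (T w) := by
  have hT' := hT.hasFDerivAt.restrictScalars ℝ
  have h1 := hf.hasFDerivAt.comp w hT'
  have h2 := hE.hasFDerivAt.comp w hT'
  rw [← jac_eq_frame]
  unfold jac angDeriv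
  rw [h1.fderiv, h2.fderiv]
  simp [mul_comm]

theorem jac_congr {f f' : ℂ → ℝ} {E E' : ℂ → ℂ} {w : ℂ} (hf : f =ᶠ[𝓝 w] f')
    (hE : E =ᶠ[𝓝 w] E') : jac f E w = jac f' E' w := by
  unfold jac angDeriv
  rw [hf.fderiv_eq, hE.fderiv_eq, hE.eq_of_nhds]

theorem jac_eq_zero {f : ℂ → ℝ} {E : ℂ → ℂ} {w : ℂ} {c : ℝ} (hf : f =ᶠ[𝓝 w] fun _ => c) :
    jac f E w = 0 := by
  unfold jac
  rw [hf.fderiv_eq]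
  simp

theorem jac_add {f f' : ℂ → ℝ} {E : ℂ → ℂ} {w : ℂ} (hf : DifferentiableAt ℝ f w)
    (hf' : DifferentiableAt ℝ f' w) :
    jac (fun z => f z + f' z) E w = jac f E w + jac f' E w := by
  unfold jac
  rw [fderiv_fun_add hf hf']
  simp
  ring

theorem jac_const_mul {f : ℂ → ℝ} {E : ℂ → ℂ} {w : ℂ} (c : ℝ) (hf : DifferentiableAt ℝ f w) :
    jac (fun z => c * f z) E w = c * jac f E w := by
  unfold jac
  rw [fderiv_const_mul hf]
  simp
  ring

/-- Wherever `E` has a real lift `y`, `d(arg E) / 2π` is `dy` and the density is an ordinary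
Jacobian. -/
theorem jac_exp {f y : ℂ → ℝ} {w : ℂ} (hy : DifferentiableAt ℝ y w) :
    jac f (fun z => Complex.exp (2 * Real.pi * y z * Complex.I)) w =
      fderiv ℝ f w 1 * fderiv ℝ y w Complex.I - fderiv ℝ f w Complex.I * fderiv ℝ y w 1 := by
  have key : ∀ v, angDeriv (fun z => Complex.exp (2 * Real.pi * y z * Complex.I)) w v =
      fderiv ℝ y w v := by
    intro v
    have h1 : HasFDerivAt (fun z => ((y z : ℝ) : ℂ)) (Complex.ofRealCLM.comp (fderiv ℝ y w)) w :=
      Complex.ofRealCLM.hasFDerivAt.comp w hy.hasFDerivAt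
    have h2 := ((h1.const_mul (2 * Real.pi : ℂ)).mul_const Complex.I).cexp
    unfold angDeriv
    rw [h2.fderiv]
    have h3 : conj (Complex.exp (2 * Real.pi * y w * Complex.I)) *
        Complex.exp (2 * Real.pi * y w * Complex.I) = 1 := by
      rw [mul_comm, Complex.mul_conj, Complex.normSq_eq_norm_sq,
        show (2 * Real.pi * y w * Complex.I : ℂ) = ((2 * Real.pi * y w : ℝ) : ℂ) * Complex.I by
          push_cast; ring, Complex.norm_exp_ofReal_mul_I]
      simp
    simp only [_root_.smul_apply, smul_eq_mul]
    rw [← mul_assoc, h3]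
    simp
  unfold jac
  rw [key, key]

theorem contDiffAt_angDeriv {E : ℂ → ℂ} {w : ℂ} (hE : ContDiffAt ℝ ∞ E w) (v : ℂ) :
    ContDiffAt ℝ ∞ (fun z => angDeriv E z v) w := by
  have h1 : ContDiffAt ℝ ∞ (fun z => fderiv ℝ E z v) w :=
    (hE.fderiv_right (m := ∞) (by simp)).clm_apply contDiffAt_const
  have h2 : ContDiffAt ℝ ∞ (fun z => conj (E z)) w :=
    (Complex.conjCLE.contDiff.contDiffAt).comp w hE
  exact ((Complex.imCLM.contDiff.contDiffAt).comp w (h2.mul h1)).div_const _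

theorem continuousAt_jac {f : ℂ → ℝ} {E : ℂ → ℂ} {w : ℂ} (hf : ContDiffAt ℝ ∞ f w)
    (hE : ContDiffAt ℝ ∞ E w) : ContinuousAt (jac f E) w := by
  have h : ∀ v, ContinuousAt (fun z => fderiv ℝ f z v) w := fun v =>
    ((hf.fderiv_right (m := ∞) (by simp)).clm_apply contDiffAt_const).continuousAt
  exact ((h 1).mul (contDiffAt_angDeriv hE _).continuousAt).sub
    ((h _).mul (contDiffAt_angDeriv hE _).continuousAt)

/-- The form `d(arg E)` is closed. -/
theorem angDeriv_closed {E : ℂ → ℂ} {w : ℂ} (hE : ContDiffAt ℝ ∞ E w)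
    (hn : ∀ᶠ z in 𝓝 w, ‖E z‖ = 1) :
    fderiv ℝ (fun z => angDeriv E z Complex.I) w 1 =
      fderiv ℝ (fun z => angDeriv E z 1) w Complex.I := by
  have hd : DifferentiableAt ℝ E w := hE.differentiableAt (by simp)
  have hd2 : DifferentiableAt ℝ (fderiv ℝ E) w :=
    (hE.fderiv_right (m := ∞) (by simp)).differentiableAt (by simp)
  have key : ∀ u v, fderiv ℝ (fun z => angDeriv E z v) w u =
      (conj (fderiv ℝ E w u) * fderiv ℝ E w v + conj (E w) * fderiv ℝ (fderiv ℝ E) w u v).im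
        / (2 * Real.pi) := by
    intro u v
    have h1 : HasFDerivAt (fun z => conj (E z))
        ((Complex.conjCLE : ℂ →L[ℝ] ℂ).comp (fderiv ℝ E w)) w :=
      (Complex.conjCLE : ℂ →L[ℝ] ℂ).hasFDerivAt.comp w hd.hasFDerivAt
    have h2 := hd2.hasFDerivAt.clm_apply (hasFDerivAt_const v w)
    have h3 := ((Complex.imCLM.hasFDerivAt.comp w (h1.mul h2)).mul_const (2 * Real.pi)⁻¹)
    have h4 : (fun z => angDeriv E z v) = fun z =>
        (Complex.imCLM ∘ ((fun z => conj (E z)) * fun z => (fderiv ℝ E z) v)) z *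
          (2 * Real.pi)⁻¹ := by
      funext z; simp [angDeriv, div_eq_mul_inv]
    rw [h4, h3.fderiv]
    simp [div_eq_mul_inv]
    ring
  have hsymm : fderiv ℝ (fderiv ℝ E) w 1 Complex.I = fderiv ℝ (fderiv ℝ E) w Complex.I 1 :=
    (hE.isSymmSndFDerivAt (by simpa using (WithTop.coe_le_coe.2 le_top : ((2 : ℕ∞) : WithTop ℕ∞) ≤ ∞))).eq 1 Complex.I
  -- Differentiating `|E|² = 1` shows that `conj E · dE` is purely imaginary.
  have hre : ∀ v, (conj (E w) * fderiv ℝ E w v).re = 0 := by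
    intro v
    have h1 : HasFDerivAt (fun z => ‖E z‖ ^ 2) (2 • (innerSL ℝ (E w)).comp (fderiv ℝ E w)) w :=
      hd.hasFDerivAt.norm_sq
    have h2 : (fun z => ‖E z‖ ^ 2) =ᶠ[𝓝 w] fun _ => (1 : ℝ) := by
      filter_upwards [hn] with z hz
      rw [hz]; norm_num
    have h3 := h1.fderiv
    rw [h2.fderiv_eq] at h3
    have h4 := congrArg (fun A : ℂ →L[ℝ] ℝ => A v) h3
    simp [Complex.inner] at h4
    simp
    linarith
  have hw : Complex.normSq (E w) = 1 := by
    rw [Complex.normSq_eq_norm_sq, hn.self_of_nhds]; norm_num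
  -- Since `|E| = 1`, this product is the conjugate of one imaginary number times another, hence
  -- real. Only the second-derivative term of `key` survives, and it is symmetric.
  have him : (conj (fderiv ℝ E w 1) * fderiv ℝ E w Complex.I).im = 0 := by
    have h5 : (conj (fderiv ℝ E w 1) * fderiv ℝ E w Complex.I) =
        conj (conj (E w) * fderiv ℝ E w 1) * (conj (E w) * fderiv ℝ E w Complex.I) := by
      have : (E w) * conj (E w) = 1 := by rw [Complex.mul_conj, hw]; simp
      simp only [map_mul, Complex.conj_conj]
      linear_combination (-(conj (fderiv ℝ E w 1) * fderiv ℝ E w Complex.I)) * this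
    rw [h5, Complex.mul_im, Complex.conj_re, Complex.conj_im, hre, hre]
    ring
  have him' : (conj (fderiv ℝ E w Complex.I) * fderiv ℝ E w 1).im = 0 := by
    have : conj (fderiv ℝ E w Complex.I) * fderiv ℝ E w 1 =
        conj (conj (fderiv ℝ E w 1) * fderiv ℝ E w Complex.I) := by simp [mul_comm]
    rw [this, Complex.conj_im, him, neg_zero]
  rw [key, key, Complex.add_im, Complex.add_im, him, him', hsymm]

/-- Stokes' theorem in the plane, for `d(h · d(arg E))` with `h` of compact support. -/
theorem integral_jac_eq_zero {h : ℂ → ℝ} {E : ℂ → ℂ} (hc : HasCompactSupport h)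
    (hh : ContDiff ℝ ∞ h) (hE : ∀ w ∈ tsupport h, ContDiffAt ℝ ∞ E w ∧ ∀ᶠ z in 𝓝 w, ‖E z‖ = 1) :
    ∫ w, jac h E w = 0 := by
  have hdh : ∀ u, ContDiff ℝ ∞ (fun w => fderiv ℝ h w u) := fun u =>
    (hh.fderiv_right (m := ∞) (by simp)).clm_apply contDiff_const
  have hsupp : ∀ u, tsupport (fun w => fderiv ℝ h w u) ⊆ tsupport h := fun u =>
    (closure_mono (fun w hw => by
      rw [Function.mem_support] at hw ⊢
      intro h0; exact hw (by rw [h0]; rfl))).trans (tsupport_fderiv_subset ℝ (f := h))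
  -- Nothing is known about `E` off the support of `h`; a factor supported there makes the product
  -- globally continuous with compact support.
  have integ : ∀ (p q : ℂ → ℝ), Continuous p → tsupport p ⊆ tsupport h →
      (∀ w ∈ tsupport h, ContinuousAt q w) → Integrable (fun w => p w * q w) := by
    intro p q hp hps hq
    have hs : tsupport (fun w => p w * q w) ⊆ tsupport p := closure_mono (fun w hw => by
      rw [Function.mem_support] at hw ⊢
      exact left_ne_zero_of_mul hw)
    refine Continuous.integrable_of_hasCompactSupport ?_
      (hc.of_isClosed_subset (isClosed_tsupport _) (hs.trans hps))
    exact continuous_of_tsupport fun w hw => hp.continuousAt.mul (hq w (hps (hs hw)))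
  have hV : ∀ v, ∀ w ∈ tsupport h, ContDiffAt ℝ ∞ (fun z => angDeriv E z v) w := fun v w hw =>
    contDiffAt_angDeriv (hE w hw).1 v
  have hdV : ∀ u v, ∀ w ∈ tsupport h,
      ContinuousAt (fun z => fderiv ℝ (fun z => angDeriv E z v) z u) w := fun u v w hw =>
    (((hV v w hw).fderiv_right (m := ∞) (by simp)).clm_apply contDiffAt_const).continuousAt
  have parts : ∀ u v, ∫ w, h w * fderiv ℝ (fun z => angDeriv E z v) w u =
      -∫ w, fderiv ℝ h w u * angDeriv E w v := fun u v =>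
    integral_mul_fderiv_eq_neg_fderiv_mul_of_integrable
      (integ _ _ (hdh u).continuous (hsupp u) fun w hw => (hV v w hw).continuousAt)
      (integ _ _ hh.continuous subset_rfl (hdV u v))
      (integ _ _ hh.continuous subset_rfl fun w hw => (hV v w hw).continuousAt)
      (fun w _ => hh.contDiffAt.differentiableAt (by simp))
      (fun w hw => (hV v w hw).differentiableAt (by simp))
  have hint : ∀ u v, Integrable (fun w => fderiv ℝ h w u * angDeriv E w v) := fun u v =>
    integ _ _ (hdh u).continuous (hsupp u) fun w hw => (hV v w hw).continuousAt
  unfold jac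
  rw [integral_sub (hint _ _) (hint _ _)]
  have h1 := parts 1 Complex.I
  have h2 := parts Complex.I 1
  have h3 : ∫ w, h w * fderiv ℝ (fun z => angDeriv E z Complex.I) w 1 =
      ∫ w, h w * fderiv ℝ (fun z => angDeriv E z 1) w Complex.I := by
    congr 1
    funext w
    by_cases hw : w ∈ tsupport h
    · rw [angDeriv_closed (hE w hw).1 (hE w hw).2]
    · rw [image_eq_zero_of_notMem_tsupport hw]; simp
  linarith

/-- Change of variables under an injective holomorphic map. -/
theorem integral_image_holomorphic {T T' : ℂ → ℂ} {s : Set ℂ} (hs : MeasurableSet s)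
    (hT : ∀ w ∈ s, HasDerivAt T (T' w) w) (hinj : InjOn T s) (h : ℂ → ℝ) :
    ∫ w in T '' s, h w = ∫ w in s, ‖T' w‖ ^ 2 * h (T w) := by
  rw [integral_image_eq_integral_abs_det_fderiv_smul volume hs
    (fun w hw => ((hT w hw).hasFDerivAt.restrictScalars ℝ).hasFDerivWithinAt) hinj]
  refine setIntegral_congr_fun hs fun w _ => ?_
  have : (ContinuousLinearMap.restrictScalars ℝ
      (ContinuousLinearMap.toSpanSingleton ℂ (T' w))).det = ‖T' w‖ ^ 2 := by
    have h1 : (ContinuousLinearMap.restrictScalars ℝ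
        (ContinuousLinearMap.toSpanSingleton ℂ (T' w))).det =
        LinearMap.det ((LinearMap.toSpanSingleton ℂ ℂ (T' w)).restrictScalars ℝ) := rfl
    rw [h1, LinearMap.det_restrictScalars, Algebra.norm_complex_apply,
      Complex.normSq_eq_norm_sq, LinearMap.det_ring]
    simp
  simp only [smul_eq_mul]
  rw [this, abs_of_nonneg (by positivity)]

end SurfaceFlux

/-! ### Integration of `df ∧ d(arg E)` over a compact Riemann surface. -/

namespace SurfaceFlux

open MeasureTheory ComplexConjugate

section Manifold

variable {S : Type*} [TopologicalSpace S] [ChartedSpace ℂ S]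

theorem isManifold_real [IsManifold 𝓘(ℂ, ℂ) ω S] : IsManifold 𝓘(ℝ, ℂ) ∞ S := by
  refine isManifold_of_contDiffOn _ _ _ fun e e' he he' => ?_
  have h : e.symm ≫ₕ e' ∈ contDiffGroupoid ω 𝓘(ℂ, ℂ) := HasGroupoid.compatible he he'
  have h2 := ((contDiffGroupoid ω 𝓘(ℂ, ℂ)).mem_iff_of_eqOnSource (Setoid.refl _)).1 h
  rw [contDiffGroupoid, mem_groupoid_of_pregroupoid] at h2
  have h3 : ContDiffOn ℂ ω (e.symm ≫ₕ e') (e.symm ≫ₕ e').source := by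
    simpa [contDiffPregroupoid] using h2.1
  have h4 : ContDiffOn ℝ ∞ (e.symm ≫ₕ e') (e.symm ≫ₕ e').source :=
    (h3.restrict_scalars ℝ).of_le le_top
  simpa using h4

/-- The density of `df ∧ d(arg E) / 2π` in the chart at `i`. -/
noncomputable def chartJac (i : S) (f : S → ℝ) (E : S → ℂ) : ℂ → ℝ :=
  jac (f ∘ (chartAt ℂ i).symm) (E ∘ (chartAt ℂ i).symm)

/-- A finite smooth partition of unity subordinate to charts. -/
structure ChartPartition (S : Type*) [TopologicalSpace S] [ChartedSpace ℂ S] where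
  t : Finset S
  χ : S → S → ℝ
  smooth : ∀ i, ContMDiff 𝓘(ℝ, ℂ) 𝓘(ℝ, ℝ) ∞ (χ i)
  nonneg : ∀ i z, 0 ≤ χ i z
  tsupport_subset : ∀ i, tsupport (χ i) ⊆ (chartAt ℂ i).source
  sum_eq_one : ∀ z, ∑ i ∈ t, χ i z = 1

theorem nonempty_chartPartition [T2Space S] [CompactSpace S] [IsManifold 𝓘(ℝ, ℂ) ∞ S] :
    Nonempty (ChartPartition S) := by
  classical
  obtain ⟨t, ht⟩ := CompactSpace.elim_nhds_subcover (fun i : S => (chartAt ℂ i).source)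
    fun i => chart_source_mem_nhds ℂ i
  -- Assigning the empty set to indices outside the finite subcover forces those functions to
  -- vanish, so the locally finite sum is a sum over `t`.
  obtain ⟨f, hf⟩ := SmoothPartitionOfUnity.exists_isSubordinate 𝓘(ℝ, ℂ) (M := S)
    (s := univ) isClosed_univ (fun i : S => if i ∈ t then (chartAt ℂ i).source else ∅)
    (fun i => by split_ifs; exacts [(chartAt ℂ i).open_source, isOpen_empty])
    (fun z _ => by
      have hz : z ∈ ⋃ x ∈ t, (chartAt ℂ x).source := by rw [ht]; trivial
      simp only [mem_iUnion] at hz ⊢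
      obtain ⟨i, hi, hz⟩ := hz
      exact ⟨i, by rwa [if_pos hi]⟩)
  refine ⟨⟨t, fun i => f i, fun i => (f i).contMDiff, fun i z => f.nonneg i z, fun i => ?_,
    fun z => ?_⟩⟩
  · refine (hf i).trans ?_
    beta_reduce
    split_ifs
    exacts [subset_rfl, empty_subset _]
  · rw [← f.sum_eq_one (mem_univ z)]
    refine (finsum_eq_sum_of_support_subset _ fun i hi => ?_).symm
    by_contra hit
    simp only [Finset.mem_coe] at hit
    have h1 : tsupport (f i) ⊆ if i ∈ t then (chartAt ℂ i).source else ∅ := hf i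
    rw [if_neg hit] at h1
    exact h1 (subset_tsupport _ hi)

/-- The integral over `S` of `df ∧ d(arg E) / 2π`. -/
noncomputable def flux (p : ChartPartition S) (f : S → ℝ) (E : S → ℂ) : ℝ :=
  ∑ i ∈ p.t, ∫ w in (chartAt ℂ i).target,
    p.χ i ((chartAt ℂ i).symm w) * chartJac i f E w

/-- Both functions are smooth at `z` and `E` has values in the circle. -/
def SmoothPair (f : S → ℝ) (E : S → ℂ) (z : S) : Prop :=
  ContMDiffAt 𝓘(ℝ, ℂ) 𝓘(ℝ, ℝ) ∞ f z ∧ ContMDiffAt 𝓘(ℝ, ℂ) 𝓘(ℝ, ℂ) ∞ E z ∧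
    ∀ᶠ y in 𝓝 z, ‖E y‖ = 1

/-- The form `df ∧ d(arg E)` makes sense everywhere. -/
def Adapted (f : S → ℝ) (E : S → ℂ) : Prop :=
  ∀ z, (f =ᶠ[𝓝 z] fun _ => f z) ∨ SmoothPair f E z

theorem Adapted.contMDiff {f : S → ℝ} {E : S → ℂ} (h : Adapted f E) :
    ContMDiff 𝓘(ℝ, ℂ) 𝓘(ℝ, ℝ) ∞ f := fun z =>
  (h z).elim (fun h => contMDiffAt_const.congr_of_eventuallyEq h) fun h => h.1

theorem tendsto_chart_symm {i : S} {w : ℂ} (hw : w ∈ (chartAt ℂ i).target) :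
    Tendsto (chartAt ℂ i).symm (𝓝 w) (𝓝 ((chartAt ℂ i).symm w)) :=
  (chartAt ℂ i).symm.continuousAt hw

theorem contDiffAt_comp_chart_symm [IsManifold 𝓘(ℝ, ℂ) ∞ S]
    {V : Type*} [NormedAddCommGroup V] [NormedSpace ℝ V]
    {f : S → V} {i : S} {w : ℂ} (hw : w ∈ (chartAt ℂ i).target)
    (hf : ContMDiffAt 𝓘(ℝ, ℂ) 𝓘(ℝ, V) ∞ f ((chartAt ℂ i).symm w)) :
    ContDiffAt ℝ ∞ (f ∘ (chartAt ℂ i).symm) w :=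
  (hf.comp w (contMDiffOn_chart_symm.contMDiffAt
    ((chartAt ℂ i).open_target.mem_nhds hw))).contDiffAt

theorem chartJac_eq_zero {f : S → ℝ} {E : S → ℂ} {i : S} {w : ℂ} {c : ℝ}
    (hw : w ∈ (chartAt ℂ i).target) (hf : f =ᶠ[𝓝 ((chartAt ℂ i).symm w)] fun _ => c) :
    chartJac i f E w = 0 :=
  jac_eq_zero (c := c) ((tendsto_chart_symm hw).eventually hf)

theorem Adapted.continuousAt_chartJac [IsManifold 𝓘(ℝ, ℂ) ∞ S]
    {f : S → ℝ} {E : S → ℂ} (h : Adapted f E) {i : S} {w : ℂ}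
    (hw : w ∈ (chartAt ℂ i).target) : ContinuousAt (chartJac i f E) w := by
  rcases h ((chartAt ℂ i).symm w) with h | h
  · have h1 : ∀ᶠ y in 𝓝 w, chartJac i f E y = 0 := by
      filter_upwards [(tendsto_chart_symm hw).eventually h.eventually_nhds,
        (chartAt ℂ i).open_target.mem_nhds hw] with y hy hy2
      exact chartJac_eq_zero hy2 hy
    exact (continuousAt_const (y := (0 : ℝ))).congr (h1.mono fun y hy => hy.symm)
  · exact continuousAt_jac (contDiffAt_comp_chart_symm hw h.1)
      (contDiffAt_comp_chart_symm hw h.2.1)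

theorem integrableOn_chart_target {i : S} {K : Set S} {q : ℂ → ℝ} (hK : IsCompact K)
    (hKs : K ⊆ (chartAt ℂ i).source) (hq : ∀ w ∈ (chartAt ℂ i).target, ContinuousAt q w)
    (hz : ∀ w ∈ (chartAt ℂ i).target, (chartAt ℂ i).symm w ∉ K → q w = 0) :
    IntegrableOn q (chartAt ℂ i).target := by
  have h1 : IsCompact (chartAt ℂ i '' K) := hK.image_of_continuousOn
    ((chartAt ℂ i).continuousOn.mono hKs)
  have h2 : chartAt ℂ i '' K ⊆ (chartAt ℂ i).target := by
    rintro _ ⟨z, hz, rfl⟩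
    exact (chartAt ℂ i).map_source (hKs hz)
  have h3 : IntegrableOn q (chartAt ℂ i '' K) := ContinuousOn.integrableOn_compact h1
    fun w hw => (hq w (h2 hw)).continuousWithinAt
  refine h3.of_forall_sdiff_eq_zero (chartAt ℂ i).open_target.measurableSet fun w hw => ?_
  exact hz w hw.1 fun hk => hw.2 ⟨_, hk, (chartAt ℂ i).right_inv hw.1⟩

theorem integrableOn_mul_chartJac [IsManifold 𝓘(ℝ, ℂ) ∞ S]
    [CompactSpace S] {f χ : S → ℝ} {E : S → ℂ} (h : Adapted f E)
    {i : S} (hχ : Continuous χ)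
    (hs : tsupport χ ⊆ (chartAt ℂ i).source ∨ tsupport f ⊆ (chartAt ℂ i).source) :
    IntegrableOn (fun w => χ ((chartAt ℂ i).symm w) * chartJac i f E w) (chartAt ℂ i).target := by
  have hc : ∀ w ∈ (chartAt ℂ i).target,
      ContinuousAt (fun w => χ ((chartAt ℂ i).symm w) * chartJac i f E w) w := fun w hw =>
    (hχ.continuousAt.comp ((chartAt ℂ i).symm.continuousAt hw)).mul (h.continuousAt_chartJac hw)
  rcases hs with hs | hs
  · refine integrableOn_chart_target (isClosed_tsupport χ).isCompact hs hc fun w _ hk => ?_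
    rw [image_eq_zero_of_notMem_tsupport hk, zero_mul]
  · refine integrableOn_chart_target (isClosed_tsupport f).isCompact hs hc fun w hw hk => ?_
    rw [chartJac_eq_zero (c := 0) hw (notMem_tsupport_iff_eventuallyEq.1 hk), mul_zero]

theorem flux_add [IsManifold 𝓘(ℝ, ℂ) ∞ S]
    [CompactSpace S] (p : ChartPartition S) {f f' : S → ℝ} {E : S → ℂ}
    (h : Adapted f E) (h' : Adapted f' E) :
    flux p (fun z => f z + f' z) E = flux p f E + flux p f' E := by
  unfold flux
  rw [← Finset.sum_add_distrib]
  refine Finset.sum_congr rfl fun i _ => ?_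
  rw [← integral_add
    (integrableOn_mul_chartJac h (p.smooth i).continuous (.inl (p.tsupport_subset i)))
    (integrableOn_mul_chartJac h' (p.smooth i).continuous (.inl (p.tsupport_subset i)))]
  refine setIntegral_congr_fun (chartAt ℂ i).open_target.measurableSet fun w hw => ?_
  have h1 := (contDiffAt_comp_chart_symm hw (h.contMDiff _)).differentiableAt (by simp)
  have h2 := (contDiffAt_comp_chart_symm hw (h'.contMDiff _)).differentiableAt (by simp)
  have h3 : chartJac i (fun z => f z + f' z) E w = chartJac i f E w + chartJac i f' E w :=
    jac_add h1 h2
  simp only [h3]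
  ring

theorem flux_const_mul [IsManifold 𝓘(ℝ, ℂ) ∞ S]
    (p : ChartPartition S) {f : S → ℝ} {E : S → ℂ} (c : ℝ)
    (h : Adapted f E) : flux p (fun z => c * f z) E = c * flux p f E := by
  unfold flux
  rw [Finset.mul_sum]
  refine Finset.sum_congr rfl fun i _ => ?_
  rw [← integral_const_mul]
  refine setIntegral_congr_fun (chartAt ℂ i).open_target.measurableSet fun w hw => ?_
  have h1 := (contDiffAt_comp_chart_symm hw (h.contMDiff _)).differentiableAt (by simp)
  have h3 : chartJac i (fun z => c * f z) E w = c * chartJac i f E w := jac_const_mul c h1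
  simp only [h3]
  ring

theorem Adapted.zero (E : S → ℂ) : Adapted (fun _ : S => (0 : ℝ)) E := fun _ =>
  .inl (Eventually.of_forall fun _ => rfl)

/-- Which alternative can be used for the sum is decided by `E` alone: where `E` is singular both
summands are locally constant, and elsewhere both are smooth. -/
theorem Adapted.add {f f' : S → ℝ} {E : S → ℂ} (h : Adapted f E) (h' : Adapted f' E) :
    Adapted (fun z => f z + f' z) E := by
  intro z
  by_cases hE : ContMDiffAt 𝓘(ℝ, ℂ) 𝓘(ℝ, ℂ) ∞ E z ∧ ∀ᶠ y in 𝓝 z, ‖E y‖ = 1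
  · exact .inr ⟨(h.contMDiff z).add (h'.contMDiff z), hE⟩
  · have h1 := (h z).resolve_right fun h => hE h.2
    have h2 := (h' z).resolve_right fun h => hE h.2
    refine .inl ?_
    filter_upwards [h1, h2] with y hy hy'
    rw [hy, hy']

theorem Adapted.const_mul {f : S → ℝ} {E : S → ℂ} (c : ℝ) (h : Adapted f E) :
    Adapted (fun z => c * f z) E := by
  intro z
  rcases h z with h | h
  · exact .inl (h.mono fun y hy => congrArg (c * ·) hy)
  · exact .inr ⟨contMDiffAt_const.mul h.1, h.2⟩

theorem Adapted.sum {ι : Type*} (s : Finset ι) {f : ι → S → ℝ} {E : S → ℂ}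
    (h : ∀ j ∈ s, Adapted (f j) E) : Adapted (fun z => ∑ j ∈ s, f j z) E := by
  classical
  induction s using Finset.induction_on with
  | empty => simpa using Adapted.zero E
  | insert j s hj ih =>
    simp only [Finset.sum_insert hj]
    exact (h j (by simp)).add (ih fun k hk => h k (by simp [hk]))

theorem flux_sum [IsManifold 𝓘(ℝ, ℂ) ∞ S]
    [CompactSpace S] (p : ChartPartition S) {ι : Type*} (s : Finset ι)
    {f : ι → S → ℝ} {E : S → ℂ} (h : ∀ j ∈ s, Adapted (f j) E) :
    flux p (fun z => ∑ j ∈ s, f j z) E = ∑ j ∈ s, flux p (f j) E := by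
  classical
  induction s using Finset.induction_on with
  | empty =>
    have := flux_const_mul p 0 (Adapted.zero E)
    simpa using this
  | insert j s hj ih =>
    simp only [Finset.sum_insert hj]
    rw [flux_add p (h j (by simp)) (Adapted.sum s fun k hk => h k (by simp [hk])),
      ih fun k hk => h k (by simp [hk])]

theorem differentiableAt_transition [IsManifold 𝓘(ℂ, ℂ) ω S]
    {i j : S} {w : ℂ} (hw : w ∈ (chartAt ℂ i).target)
    (hw' : (chartAt ℂ i).symm w ∈ (chartAt ℂ j).source) :
    DifferentiableAt ℂ (chartAt ℂ j ∘ (chartAt ℂ i).symm) w := by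
  have h1 : ContMDiffAt 𝓘(ℂ, ℂ) 𝓘(ℂ, ℂ) ω (chartAt ℂ i).symm w :=
    contMDiffOn_chart_symm.contMDiffAt ((chartAt ℂ i).open_target.mem_nhds hw)
  have h2 : ContMDiffAt 𝓘(ℂ, ℂ) 𝓘(ℂ, ℂ) ω (chartAt ℂ j) ((chartAt ℂ i).symm w) :=
    contMDiffOn_chart.contMDiffAt ((chartAt ℂ j).open_source.mem_nhds hw')
  exact (h2.comp w h1).contDiffAt.differentiableAt (by simp)

/-- Chart changes are holomorphic, so the densities differ by a conformal factor. Being nonnegative,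
this factor also lets the sign of a density be tested in any chart. -/
theorem Adapted.chartJac_transition [IsManifold 𝓘(ℝ, ℂ) ∞ S] [IsManifold 𝓘(ℂ, ℂ) ω S]
    {f : S → ℝ} {E : S → ℂ} (h : Adapted f E) {i j : S} {w : ℂ}
    (hw : w ∈ (chartAt ℂ i).target) (hw' : (chartAt ℂ i).symm w ∈ (chartAt ℂ j).source) :
    chartJac i f E w = ‖deriv (chartAt ℂ j ∘ (chartAt ℂ i).symm) w‖ ^ 2 *
      chartJac j f E (chartAt ℂ j ((chartAt ℂ i).symm w)) := by
  have hT := (differentiableAt_transition hw hw').hasDerivAt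
  have ht := (chartAt ℂ j).map_source hw'
  have hl := (chartAt ℂ j).left_inv hw'
  rcases h ((chartAt ℂ i).symm w) with h | h
  · rw [chartJac_eq_zero hw h, chartJac_eq_zero (c := f ((chartAt ℂ i).symm w)) ht
      (by rw [hl]; exact h), mul_zero]
  · have hev : ∀ᶠ y in 𝓝 w, (chartAt ℂ j).symm (chartAt ℂ j ((chartAt ℂ i).symm y)) =
        (chartAt ℂ i).symm y := by
      filter_upwards [(tendsto_chart_symm hw).eventually
        ((chartAt ℂ j).open_source.mem_nhds hw')] with y hy
      exact (chartAt ℂ j).left_inv hy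
    have h1 : DifferentiableAt ℝ (f ∘ (chartAt ℂ j).symm)
        ((chartAt ℂ j ∘ (chartAt ℂ i).symm) w) :=
      (contDiffAt_comp_chart_symm ht (by rw [hl]; exact h.1)).differentiableAt (by simp)
    have h2 : DifferentiableAt ℝ (E ∘ (chartAt ℂ j).symm)
        ((chartAt ℂ j ∘ (chartAt ℂ i).symm) w) :=
      (contDiffAt_comp_chart_symm ht (by rw [hl]; exact h.2.1)).differentiableAt (by simp)
    have h3 := jac_comp hT h1 h2
    refine Eq.trans (jac_congr ?_ ?_) h3
    · filter_upwards [hev] with y hy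
      simp [hy]
    · filter_upwards [hev] with y hy
      simp [hy]

/-- The integrands vanish off the overlap of the charts, on one side because of `f` and on the other
because of `χ`. On the overlap this is the change of variables formula. -/
theorem Adapted.integral_chart_eq [IsManifold 𝓘(ℝ, ℂ) ∞ S] [IsManifold 𝓘(ℂ, ℂ) ω S]
    {f : S → ℝ} {E : S → ℂ} (h : Adapted f E) {i j : S}
    {χ : S → ℝ} (hχ : tsupport χ ⊆ (chartAt ℂ i).source)
    (hf : tsupport f ⊆ (chartAt ℂ j).source) :
    ∫ w in (chartAt ℂ i).target, χ ((chartAt ℂ i).symm w) * chartJac i f E w =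
      ∫ w in (chartAt ℂ j).target, χ ((chartAt ℂ j).symm w) * chartJac j f E w := by
  set T := (chartAt ℂ i).symm.trans (chartAt ℂ j) with hTdef
  have hsrc : T.source = (chartAt ℂ i).target ∩ (chartAt ℂ i).symm ⁻¹' (chartAt ℂ j).source := by
    simp [hTdef]
  have htgt : T.target = (chartAt ℂ j).target ∩ (chartAt ℂ j).symm ⁻¹' (chartAt ℂ i).source := by
    simp [hTdef]
  have e1 : ∫ w in (chartAt ℂ i).target, χ ((chartAt ℂ i).symm w) * chartJac i f E w =
      ∫ w in T.source, χ ((chartAt ℂ i).symm w) * chartJac i f E w := by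
    refine setIntegral_eq_of_subset_of_forall_sdiff_eq_zero
      (chartAt ℂ i).open_target.measurableSet (by rw [hsrc]; exact inter_subset_left)
      fun w hw => ?_
    have h2 : (chartAt ℂ i).symm w ∉ tsupport f := fun h3 => hw.2 (by
      rw [hsrc]; exact ⟨hw.1, hf h3⟩)
    rw [chartJac_eq_zero (c := 0) hw.1 (notMem_tsupport_iff_eventuallyEq.1 h2), mul_zero]
  have e2 : ∫ w in (chartAt ℂ j).target, χ ((chartAt ℂ j).symm w) * chartJac j f E w =
      ∫ w in T.target, χ ((chartAt ℂ j).symm w) * chartJac j f E w := by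
    refine setIntegral_eq_of_subset_of_forall_sdiff_eq_zero
      (chartAt ℂ j).open_target.measurableSet (by rw [htgt]; exact inter_subset_left)
      fun w hw => ?_
    have h2 : (chartAt ℂ j).symm w ∉ tsupport χ := fun h3 => hw.2 (by
      rw [htgt]; exact ⟨hw.1, hχ h3⟩)
    rw [image_eq_zero_of_notMem_tsupport h2, zero_mul]
  rw [e1, e2, ← T.image_source_eq_target, integral_image_holomorphic
    (T' := deriv (chartAt ℂ j ∘ (chartAt ℂ i).symm)) T.open_source.measurableSet
    (fun w hw => by
      rw [hsrc] at hw
      exact (differentiableAt_transition hw.1 hw.2).hasDerivAt) T.injOn]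
  refine setIntegral_congr_fun T.open_source.measurableSet fun w hw => ?_
  rw [hsrc] at hw
  have hTw : T w = chartAt ℂ j ((chartAt ℂ i).symm w) := rfl
  simp only [hTw, (chartAt ℂ j).left_inv hw.2]
  rw [h.chartJac_transition hw.1 hw.2]
  ring

/-- The integral of a form supported in one chart can be computed in that chart. -/
theorem flux_eq_of_tsupport_subset [IsManifold 𝓘(ℝ, ℂ) ∞ S] [IsManifold 𝓘(ℂ, ℂ) ω S]
    [CompactSpace S] (p : ChartPartition S) {f : S → ℝ} {E : S → ℂ}
    (h : Adapted f E) {j : S} (hf : tsupport f ⊆ (chartAt ℂ j).source) :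
    flux p f E = ∫ w in (chartAt ℂ j).target, chartJac j f E w := by
  unfold flux
  rw [Finset.sum_congr rfl fun i _ => h.integral_chart_eq (p.tsupport_subset i) hf,
    ← integral_finsetSum _ fun i _ =>
      integrableOn_mul_chartJac h (p.smooth i).continuous (.inr hf)]
  refine setIntegral_congr_fun (chartAt ℂ j).open_target.measurableSet fun w _ => ?_
  rw [← Finset.sum_mul, p.sum_eq_one, one_mul]

/-- The function `f` in the chart at `j`, extended by zero. -/
noncomputable def chartExtend (j : S) (f : S → ℝ) : ℂ → ℝ :=
  indicator (chartAt ℂ j).target (f ∘ (chartAt ℂ j).symm)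

theorem isCompact_image_tsupport [CompactSpace S] {j : S} {f : S → ℝ}
    (hf : tsupport f ⊆ (chartAt ℂ j).source) : IsCompact (chartAt ℂ j '' tsupport f) :=
  (isClosed_tsupport f).isCompact.image_of_continuousOn ((chartAt ℂ j).continuousOn.mono hf)

theorem tsupport_chartExtend_subset [CompactSpace S] {j : S} {f : S → ℝ}
    (hf : tsupport f ⊆ (chartAt ℂ j).source) :
    tsupport (chartExtend j f) ⊆ chartAt ℂ j '' tsupport f := by
  refine closure_minimal (fun w hw => ?_) (isCompact_image_tsupport hf).isClosed
  rw [chartExtend, Function.mem_support, indicator_apply_ne_zero] at hw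
  exact ⟨_, subset_tsupport _ hw.2, (chartAt ℂ j).right_inv hw.1⟩

theorem chartExtend_eventuallyEq {j : S} (f : S → ℝ) {w : ℂ} (hw : w ∈ (chartAt ℂ j).target) :
    chartExtend j f =ᶠ[𝓝 w] f ∘ (chartAt ℂ j).symm := by
  filter_upwards [(chartAt ℂ j).open_target.mem_nhds hw] with y hy
  exact indicator_of_mem hy _

theorem integral_chartJac_eq [CompactSpace S] {j : S} {f : S → ℝ} (E : S → ℂ)
    (hf : tsupport f ⊆ (chartAt ℂ j).source) :
    ∫ w in (chartAt ℂ j).target, chartJac j f E w =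
      ∫ w, jac (chartExtend j f) (E ∘ (chartAt ℂ j).symm) w := by
  have e1 : ∫ w in (chartAt ℂ j).target, chartJac j f E w =
      ∫ w in (chartAt ℂ j).target, jac (chartExtend j f) (E ∘ (chartAt ℂ j).symm) w :=
    setIntegral_congr_fun (chartAt ℂ j).open_target.measurableSet fun w hw =>
      (jac_congr (chartExtend_eventuallyEq f hw) EventuallyEq.rfl).symm
  rw [e1]
  refine setIntegral_eq_integral_of_forall_compl_eq_zero fun w hw => ?_
  refine jac_eq_zero (c := 0) (notMem_tsupport_iff_eventuallyEq.1 fun h => hw ?_)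
  obtain ⟨z, hz, rfl⟩ := tsupport_chartExtend_subset hf h
  exact (chartAt ℂ j).map_source (hf hz)

/-- Stokes' theorem for `d(f · d(arg E))` if `f` vanishes near the singularities of `E`. -/
theorem flux_eq_zero [IsManifold 𝓘(ℝ, ℂ) ∞ S] [IsManifold 𝓘(ℂ, ℂ) ω S]
    [CompactSpace S] (p : ChartPartition S) {f : S → ℝ} {E : S → ℂ}
    (h : ∀ z, f =ᶠ[𝓝 z] 0 ∨ SmoothPair f E z) : flux p f E = 0 := by
  have hts : ∀ j, tsupport (fun z => p.χ j z * f z) ⊆ tsupport (p.χ j) := fun j =>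
    closure_mono fun z hz => by
      rw [Function.mem_support] at hz ⊢
      exact left_ne_zero_of_mul hz
  have hts' : ∀ j, tsupport (fun z => p.χ j z * f z) ⊆ tsupport f := fun j =>
    closure_mono fun z hz => by
      rw [Function.mem_support] at hz ⊢
      exact right_ne_zero_of_mul hz
  have hj : ∀ j, Adapted (fun z => p.χ j z * f z) E := by
    intro j z
    rcases h z with h | h
    · exact .inl (h.mono fun y hy => by simp [hy, h.self_of_nhds])
    · exact .inr ⟨(p.smooth j z).mul h.1, h.2⟩
  -- Each piece is supported in one chart, where extension by zero reduces the statement to Stokes'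
  -- theorem in the plane.
  have hsum : f = fun z => ∑ j ∈ p.t, p.χ j z * f z := by
    funext z
    rw [← Finset.sum_mul, p.sum_eq_one, one_mul]
  rw [hsum, flux_sum p p.t fun j _ => hj j]
  refine Finset.sum_eq_zero fun j _ => ?_
  have hsub := (hts j).trans (p.tsupport_subset j)
  rw [flux_eq_of_tsupport_subset p (hj j) hsub, integral_chartJac_eq E hsub]
  have hsub2 := tsupport_chartExtend_subset hsub
  refine integral_jac_eq_zero ((isCompact_image_tsupport hsub).of_isClosed_subset
    (isClosed_tsupport _) hsub2) ?_ ?_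
  · have h1 : ∀ w ∈ tsupport (chartExtend j fun z => p.χ j z * f z),
        ContDiffAt ℝ ∞ (chartExtend j fun z => p.χ j z * f z) w := by
      intro w hw
      obtain ⟨z, hz, rfl⟩ := hsub2 hw
      have ht := (chartAt ℂ j).map_source (hsub hz)
      exact (contDiffAt_comp_chart_symm ht ((hj j).contMDiff _)).congr_of_eventuallyEq
        (chartExtend_eventuallyEq _ ht)
    exact (contMDiff_of_tsupport fun w hw => (h1 w hw).contMDiffAt).contDiff
  · intro w hw
    obtain ⟨z, hz, rfl⟩ := hsub2 hw
    have ht := (chartAt ℂ j).map_source (hsub hz)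
    have hl := (chartAt ℂ j).left_inv (hsub hz)
    have hp := (h z).resolve_left fun h0 => by
      exact (notMem_tsupport_iff_eventuallyEq.2 h0) (hts' j hz)
    refine ⟨contDiffAt_comp_chart_symm ht (by rw [hl]; exact hp.2.1), ?_⟩
    have h2 : ∀ᶠ y in 𝓝 ((chartAt ℂ j).symm (chartAt ℂ j z)), ‖E y‖ = 1 := by
      rw [hl]
      exact hp.2.2
    exact (tendsto_chart_symm ht).eventually h2

end Manifold

end SurfaceFlux

/-! ### Winding numbers and Stokes' theorem on a punctured surface. -/

namespace SurfaceFlux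

open MeasureTheory ComplexConjugate

/-- The derivative of a continuous lift of a circle-valued function. -/
theorem hasDerivAt_lift {y : ℝ → ℝ} {e : ℝ → ℂ} {e' : ℂ} {τ : ℝ} (hy : ContinuousAt y τ)
    (he : ∀ᶠ s in 𝓝 τ, e s = Complex.exp (2 * Real.pi * y s * Complex.I))
    (hd : HasDerivAt e e' τ) : HasDerivAt y ((conj (e τ) * e').im / (2 * Real.pi)) τ := by
  have hexp : ∀ s, (2 * Real.pi * y s * Complex.I : ℂ) =
      ((2 * Real.pi * y s : ℝ) : ℂ) * Complex.I := fun s => by push_cast; ring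
  have h0 := he.self_of_nhds
  have hn : conj (e τ) * e τ = 1 := by
    rw [mul_comm, Complex.mul_conj, Complex.normSq_eq_norm_sq, h0, hexp,
      Complex.norm_exp_ofReal_mul_I]
    simp
  have h1 : HasDerivAt (fun s => conj (e τ) * e s) (conj (e τ) * e') τ := hd.const_mul _
  have h2 : HasDerivAt (fun s => Complex.log (conj (e τ) * e s)) ((conj (e τ) * e') / 1) τ := by
    have h3 := h1.clog_real (by rw [hn]; exact Complex.one_mem_slitPlane)
    rwa [hn] at h3
  have h4 : HasDerivAt (fun s => y τ + (Complex.log (conj (e τ) * e s)).im / (2 * Real.pi))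
      ((conj (e τ) * e').im / (2 * Real.pi)) τ := by
    have h5 := (Complex.imCLM.hasFDerivAt.comp_hasDerivAt τ h2).div_const (2 * Real.pi)
    simpa using h5.const_add (y τ)
  refine h4.congr_of_eventuallyEq ?_
  -- The angle of `conj (e τ) * e s` then stays in `(-π, π)`, so the principal logarithm recovers `y
  -- s - y τ` without ambiguity.
  have h6 : ∀ᶠ s in 𝓝 τ, |y s - y τ| < 1 / 2 := by
    have := Metric.continuousAt_iff'.1 hy (1 / 2) (by norm_num)
    simpa [Real.dist_eq] using this
  filter_upwards [he, h6] with s hs hs2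
  have h7 : conj (e τ) * e s = Complex.exp (((2 * Real.pi * (y s - y τ) : ℝ) : ℂ) * Complex.I) := by
    rw [hs, h0, hexp, hexp, ← Complex.exp_conj, ← Complex.exp_add]
    congr 1
    simp only [map_mul, Complex.conj_ofReal, Complex.conj_I]
    push_cast
    ring
  have hpi := Real.pi_pos
  rw [abs_lt] at hs2
  rw [h7, Complex.log_exp]
  · simp
  · simp; nlinarith
  · simp; nlinarith

/-- A radial cutoff function, equal to `1` on the disc of radius `R` and to `0` off the disc of
radius `2R`. -/
noncomputable def radialBump (w₀ : ℂ) (R : ℝ) (w : ℂ) : ℝ :=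
  Real.smoothTransition (2 - ‖w - w₀‖ ^ 2 / R ^ 2)

theorem radialBump_eq_one {w₀ w : ℂ} {R : ℝ} (hR : 0 < R) (h : ‖w - w₀‖ ≤ R) :
    radialBump w₀ R w = 1 := by
  refine Real.smoothTransition.one_of_one_le ?_
  have : ‖w - w₀‖ ^ 2 / R ^ 2 ≤ 1 := by
    rw [div_le_one (by positivity)]
    gcongr
  linarith

/-- The constant works because `(3/2)² ≥ 2`; it leaves room inside the disc of radius `2R`. -/
theorem radialBump_eq_zero {w₀ w : ℂ} {R : ℝ} (hR : 0 < R) (h : 3 / 2 * R ≤ ‖w - w₀‖) :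
    radialBump w₀ R w = 0 := by
  refine Real.smoothTransition.zero_of_nonpos ?_
  have : 2 ≤ ‖w - w₀‖ ^ 2 / R ^ 2 := by
    rw [le_div_iff₀ (by positivity)]
    nlinarith
  linarith

theorem contDiff_radialBump (w₀ : ℂ) (R : ℝ) : ContDiff ℝ ∞ (radialBump w₀ R) := by
  refine Real.smoothTransition.contDiff.comp (contDiff_const.sub ?_)
  exact ((contDiff_id.sub contDiff_const).norm_sq ℝ).div_const _

/-- The radial profile of `radialBump`. -/
noncomputable def bumpProfile (R r : ℝ) : ℝ := Real.smoothTransition (2 - r ^ 2 / R ^ 2)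

theorem contDiff_bumpProfile (R : ℝ) : ContDiff ℝ ∞ (bumpProfile R) :=
  Real.smoothTransition.contDiff.comp
    (contDiff_const.sub ((contDiff_id.pow 2).div_const _))

/-- In the frame `e, ie` the tangential derivative drops out, so in polar coordinates the density is
a radial derivative times the angular derivative of `E` along circles. -/
theorem radialBump_fderiv {w₀ e : ℂ} {R r : ℝ} (he : ‖e‖ = 1) :
    fderiv ℝ (radialBump w₀ R) (w₀ + r * e) e = deriv (bumpProfile R) r ∧
      fderiv ℝ (radialBump w₀ R) (w₀ + r * e) (e * Complex.I) = 0 := by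
  have hs : ∀ x, HasDerivAt Real.smoothTransition (deriv Real.smoothTransition x) x := fun x =>
    (Real.smoothTransition.contDiff (n := 1)).differentiable (by simp) x |>.hasDerivAt
  have h1 : HasDerivAt (bumpProfile R)
      (deriv Real.smoothTransition (2 - r ^ 2 / R ^ 2) * (-(2 * r / R ^ 2))) r := by
    have h2 : HasDerivAt (fun r : ℝ => 2 - r ^ 2 / R ^ 2) (-(2 * r / R ^ 2)) r := by
      have := ((hasDerivAt_pow 2 r).div_const (R ^ 2)).const_sub 2
      simpa using this
    exact (hs _).comp r h2
  have hn : ‖w₀ + r * e - w₀‖ ^ 2 = r ^ 2 := by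
    rw [add_sub_cancel_left, norm_mul, he]
    simp
  have h3 : HasFDerivAt (fun w : ℂ => 2 - ‖w - w₀‖ ^ 2 * (R ^ 2)⁻¹) (-((R ^ 2)⁻¹ •
      (2 • (innerSL ℝ (w₀ + r * e - w₀)).comp (ContinuousLinearMap.id ℝ ℂ)))) (w₀ + r * e) :=
    (((((hasFDerivAt_id (𝕜 := ℝ) (w₀ + r * e)).sub_const w₀).norm_sq).mul_const
      ((R ^ 2)⁻¹ : ℝ)).const_sub (2 : ℝ))
  obtain ⟨A, hA⟩ : ∃ A : ℂ →L[ℝ] ℝ, A = -((R ^ 2)⁻¹ •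
      (2 • (innerSL ℝ (w₀ + r * e - w₀)).comp (ContinuousLinearMap.id ℝ ℂ))) := ⟨_, rfl⟩
  rw [← hA] at h3
  have h4 : HasFDerivAt (radialBump w₀ R)
      (deriv Real.smoothTransition (2 - ‖w₀ + r * e - w₀‖ ^ 2 * (R ^ 2)⁻¹) • A) (w₀ + r * e) :=
    HasDerivAt.comp_hasFDerivAt (h₂ := Real.smoothTransition) (w₀ + r * e) (hs _) h3
  rw [h4.fderiv, h1.deriv]
  simp only [hn, hA]
  have he2 : e.re * e.re + e.im * e.im = 1 := by
    rw [← Complex.normSq_apply, Complex.normSq_eq_norm_sq, he]; norm_num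
  constructor
  · simp [Complex.inner, div_eq_mul_inv]
    left
    linear_combination (2 * r) * (R ^ 2)⁻¹ * he2
  · simp [Complex.inner]
    right; right
    ring

theorem integral_deriv_bumpProfile {R : ℝ} (hR : 0 < R) :
    ∫ r in Icc R (2 * R), deriv (bumpProfile R) r = -1 := by
  rw [integral_Icc_eq_integral_Ioc, ← intervalIntegral.integral_of_le (by linarith),
    intervalIntegral.integral_deriv_eq_sub
      (fun r _ => (contDiff_bumpProfile R).differentiable (by simp) r)
      (((contDiff_bumpProfile R).continuous_deriv (by simp)).intervalIntegrable _ _)]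
  have h1 : bumpProfile R R = 1 := by
    refine Real.smoothTransition.one_of_one_le ?_
    rw [div_self (by positivity)]; norm_num
  have h2 : bumpProfile R (2 * R) = 0 := by
    refine Real.smoothTransition.zero_of_nonpos ?_
    have : (2 * R) ^ 2 / R ^ 2 = 4 := by field_simp; norm_num
    rw [this]; norm_num
  rw [h1, h2]; norm_num

theorem deriv_bumpProfile_eq_zero {R r : ℝ} (hR : 0 < R) (hr : 0 < r)
    (h : r ∉ Icc R (2 * R)) : deriv (bumpProfile R) r = 0 := by
  rw [mem_Icc, not_and_or, not_le, not_le] at h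
  rcases h with h | h
  · have : bumpProfile R =ᶠ[𝓝 r] fun _ => 1 := by
      filter_upwards [Ioo_mem_nhds hr h] with s hs
      refine Real.smoothTransition.one_of_one_le ?_
      have : s ^ 2 / R ^ 2 ≤ 1 := by
        rw [div_le_one (by positivity)]
        nlinarith [hs.1, hs.2]
      linarith
    rw [this.deriv_eq]; simp
  · have : bumpProfile R =ᶠ[𝓝 r] fun _ => 0 := by
      filter_upwards [Ioi_mem_nhds h] with s hs
      refine Real.smoothTransition.zero_of_nonpos ?_
      have : 2 ≤ s ^ 2 / R ^ 2 := by
        rw [le_div_iff₀ (by positivity)]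
        nlinarith [mem_Ioi.1 hs]
      linarith
    rw [this.deriv_eq]; simp

/-- The point with polar coordinates `(r, θ)` around `w₀`. -/
noncomputable def polarPt (w₀ : ℂ) (p : ℝ × ℝ) : ℂ :=
  w₀ + p.1 * Complex.exp (p.2 * Complex.I)

theorem norm_polarPt_sub (w₀ : ℂ) (p : ℝ × ℝ) : ‖polarPt w₀ p - w₀‖ = |p.1| := by
  rw [polarPt, add_sub_cancel_left, norm_mul, Complex.norm_exp_ofReal_mul_I]
  simp

theorem continuous_polarPt (w₀ : ℂ) : Continuous (polarPt w₀) := by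
  unfold polarPt; fun_prop

/-- The angular derivative along the circle of radius `r` around `w₀`. -/
noncomputable def circDeriv (E : ℂ → ℂ) (w₀ : ℂ) (p : ℝ × ℝ) : ℝ :=
  angDeriv E (polarPt w₀ p) (p.1 * (Complex.exp (p.2 * Complex.I) * Complex.I))

theorem continuousAt_circDeriv {E : ℂ → ℂ} {w₀ : ℂ} {p : ℝ × ℝ}
    (hE : ContDiffAt ℝ ∞ E (polarPt w₀ p)) : ContinuousAt (circDeriv E w₀) p := by
  have h1 : ContinuousAt (fun q => fderiv ℝ E (polarPt w₀ q)) p :=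
    ContinuousAt.comp (g := fderiv ℝ E) (hE.fderiv_right (m := ∞) (by simp)).continuousAt
      (continuous_polarPt w₀).continuousAt
  have h2 : ContinuousAt (fun q => conj (E (polarPt w₀ q))) p :=
    Complex.continuous_conj.continuousAt.comp
      (ContinuousAt.comp (g := E) hE.continuousAt (continuous_polarPt w₀).continuousAt)
  have h3 : Continuous fun q : ℝ × ℝ =>
      (q.1 * (Complex.exp (q.2 * Complex.I) * Complex.I) : ℂ) := by fun_prop
  exact (Complex.continuous_im.continuousAt.comp
    (h2.mul (h1.clm_apply h3.continuousAt))).div_const _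

/-- The sign comes from the orientation of `endCoord`: the polar angle is `-2πτ`, so circles are run
through clockwise as `τ` increases. -/
theorem integral_circDeriv {E : ℂ → ℂ} {w₀ : ℂ} {r k : ℝ} {y : ℝ → ℝ}
    (hE : ∀ θ, ContDiffAt ℝ ∞ E (polarPt w₀ (r, θ))) (hy : Continuous y)
    (hl : ∀ τ, E (polarPt w₀ (r, -(2 * Real.pi * τ))) =
      Complex.exp (2 * Real.pi * y τ * Complex.I)) (hk : y 1 - y 0 = k) :
    ∫ θ in (-Real.pi)..Real.pi, circDeriv E w₀ (r, θ) = -k := by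
  have hcont : Continuous fun θ => circDeriv E w₀ (r, θ) := continuous_iff_continuousAt.2 fun θ =>
    ContinuousAt.comp (g := circDeriv E w₀) (continuousAt_circDeriv (hE θ))
      (Continuous.continuousAt (by fun_prop))
  have hd : ∀ τ, HasDerivAt y (-(2 * Real.pi) * circDeriv E w₀ (r, -(2 * Real.pi) * τ)) τ := by
    intro τ
    have h1 : HasDerivAt (fun τ : ℝ => polarPt w₀ (r, -(2 * Real.pi * τ)))
        (r * (Complex.exp ((-(2 * Real.pi * τ) : ℝ) * Complex.I) *
          (-(2 * Real.pi) * Complex.I))) τ := by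
      have h2 : HasDerivAt (fun τ : ℝ => ((-(2 * Real.pi * τ) : ℝ) : ℂ) * Complex.I)
          (-(2 * Real.pi) * Complex.I) τ := by
        have h3 : HasDerivAt (fun τ : ℝ => -(2 * Real.pi * τ)) (-(2 * Real.pi)) τ := by
          have := (hasDerivAt_id τ).const_mul (-(2 * Real.pi))
          simpa using this
        simpa using h3.ofReal_comp.mul_const Complex.I
      exact (h2.cexp.const_mul (r : ℂ)).const_add w₀
    have h4 := (hE (-(2 * Real.pi * τ))).differentiableAt (by simp) |>.hasFDerivAt
    have h5 := h4.comp_hasDerivAt τ h1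
    have h6 := hasDerivAt_lift hy.continuousAt (Eventually.of_forall hl) h5
    convert h6 using 1
    unfold circDeriv angDeriv
    have h7 : (r * (Complex.exp ((-(2 * Real.pi * τ) : ℝ) * Complex.I) *
          (-(2 * Real.pi) * Complex.I)) : ℂ) = (-(2 * Real.pi) : ℝ) •
        ((r : ℂ) * (Complex.exp ((-(2 * Real.pi * τ) : ℝ) * Complex.I) * Complex.I)) := by
      rw [Complex.real_smul]; push_cast; ring
    have h8 : -(2 * Real.pi) * τ = -(2 * Real.pi * τ) := by ring
    rw [h7, map_smul, h8]
    simp only [Complex.real_smul, ← mul_assoc, Complex.mul_im, Complex.ofReal_re,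
      Complex.ofReal_im, Complex.mul_re]
    ring
  have h1 : ∫ τ in (0 : ℝ)..1, -(2 * Real.pi) * circDeriv E w₀ (r, -(2 * Real.pi) * τ) = k := by
    rw [intervalIntegral.integral_eq_sub_of_hasDerivAt (fun τ _ => hd τ), hk]
    exact (Continuous.intervalIntegrable (continuous_const.mul
      (hcont.comp (continuous_const.mul continuous_id))) _ _)
  rw [intervalIntegral.integral_const_mul,
    intervalIntegral.mul_integral_comp_mul_left (f := fun θ => circDeriv E w₀ (r, θ))] at h1
  -- The substitution covers `[-2π, 0]`; periodicity moves the integral to the range `[-π, π]` of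
  -- polar coordinates.
  have hper : Function.Periodic (fun θ => circDeriv E w₀ (r, θ)) (2 * Real.pi) := by
    intro θ
    have h9 : Complex.exp (((θ + 2 * Real.pi : ℝ) : ℂ) * Complex.I) =
        Complex.exp ((θ : ℂ) * Complex.I) := by
      rw [← Complex.exp_periodic ((θ : ℂ) * Complex.I)]
      congr 1; push_cast; ring
    simp only [circDeriv, polarPt, h9]
  have h10 := hper.intervalIntegral_add_eq (-Real.pi) (-(2 * Real.pi))
  rw [show -Real.pi + 2 * Real.pi = Real.pi by ring,
    show -(2 * Real.pi) + 2 * Real.pi = 0 by ring] at h10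
  rw [h10, ← h1, mul_zero, mul_one, intervalIntegral.integral_symm]

/-- The integral of `d(bump) ∧ d(arg E)` is the winding number of `E`. -/
theorem integral_jac_radialBump {E : ℂ → ℂ} {w₀ : ℂ} {R k : ℝ} (hR : 0 < R)
    (hE : ∀ w, R ≤ ‖w - w₀‖ → ‖w - w₀‖ ≤ 2 * R → ContDiffAt ℝ ∞ E w)
    (hw : ∀ r ∈ Icc R (2 * R), ∃ y : ℝ → ℝ, Continuous y ∧
      (∀ τ, E (polarPt w₀ (r, -(2 * Real.pi * τ))) =
        Complex.exp (2 * Real.pi * y τ * Complex.I)) ∧ y 1 - y 0 = k) :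
    ∫ w, jac (radialBump w₀ R) E w = k := by
  have hE' : ∀ r ∈ Icc R (2 * R), ∀ θ, ContDiffAt ℝ ∞ E (polarPt w₀ (r, θ)) := fun r hr θ =>
    hE _ (by rw [norm_polarPt_sub, abs_of_nonneg (hR.le.trans hr.1)]; exact hr.1)
      (by rw [norm_polarPt_sub, abs_of_nonneg (hR.le.trans hr.1)]; exact hr.2)
  set F : ℝ × ℝ → ℝ := fun p => deriv (bumpProfile R) p.1 * circDeriv E w₀ p with hF
  have h1 : ∫ w, jac (radialBump w₀ R) E w = ∫ p in polarCoord.target, F p := by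
    rw [← integral_add_left_eq_self (fun w => jac (radialBump w₀ R) E w) w₀,
      ← Complex.integral_comp_polarCoord_symm]
    refine setIntegral_congr_fun polarCoord.open_target.measurableSet fun p _ => ?_
    have he : ‖Complex.exp (p.2 * Complex.I)‖ = 1 := Complex.norm_exp_ofReal_mul_I _
    have h2 : (p.1 : ℂ) * (Real.cos p.2 + Real.sin p.2 * Complex.I) =
        p.1 * Complex.exp (p.2 * Complex.I) := by
      rw [Complex.exp_mul_I]; push_cast; rfl
    have h3 := jac_eq_frame (radialBump w₀ R) E (w₀ + p.1 * Complex.exp (p.2 * Complex.I))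
      (Complex.exp (p.2 * Complex.I))
    rw [(radialBump_fderiv he).1, (radialBump_fderiv he).2, he] at h3
    simp only [Complex.polarCoord_symm_apply, h2, hF, circDeriv, smul_eq_mul]
    have h4 : angDeriv E (polarPt w₀ p) (p.1 * (Complex.exp (p.2 * Complex.I) * Complex.I)) =
        p.1 * angDeriv E (polarPt w₀ p) (Complex.exp (p.2 * Complex.I) * Complex.I) := by
      unfold angDeriv
      rw [← Complex.real_smul, map_smul]
      simp only [Complex.real_smul, Complex.mul_im, Complex.mul_re, Complex.ofReal_re,
        Complex.ofReal_im]
      ring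
    rw [h4]
    simp only [polarPt]
    linear_combination (-p.1) * h3
  have h2 : ∫ p in polarCoord.target, F p =
      ∫ p in Icc R (2 * R) ×ˢ Ioo (-Real.pi) Real.pi, F p := by
    rw [polarCoord_target]
    refine setIntegral_eq_of_subset_of_forall_sdiff_eq_zero
      (measurableSet_Ioi.prod measurableSet_Ioo)
      (prod_mono (fun r hr => hR.trans_le hr.1) subset_rfl) fun p hp => ?_
    have : p.1 ∉ Icc R (2 * R) := fun h => hp.2 ⟨h, hp.1.2⟩
    simp only [hF]
    rw [deriv_bumpProfile_eq_zero hR hp.1.1 this, zero_mul]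
  have hint : IntegrableOn F (Icc R (2 * R) ×ˢ Ioo (-Real.pi) Real.pi) := by
    have hc : ContinuousOn F (Icc R (2 * R) ×ˢ Icc (-Real.pi) Real.pi) := fun p hp =>
      (((((contDiff_bumpProfile R).continuous_deriv (by simp)).comp continuous_fst).continuousAt).mul
        (continuousAt_circDeriv (hE' p.1 hp.1 p.2))).continuousWithinAt
    exact (hc.integrableOn_compact (isCompact_Icc.prod isCompact_Icc)).mono_set
      (prod_mono subset_rfl Ioo_subset_Icc_self)
  rw [h1, h2, Measure.volume_eq_prod, setIntegral_prod _ hint]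
  have h3 : ∫ r in Icc R (2 * R), ∫ θ in Ioo (-Real.pi) Real.pi, F (r, θ) =
      ∫ r in Icc R (2 * R), deriv (bumpProfile R) r * (-k) := by
    refine setIntegral_congr_fun measurableSet_Icc fun r hr => ?_
    obtain ⟨y, hy, hl, hk⟩ := hw r hr
    simp only [hF]
    rw [integral_const_mul, ← integral_Ioc_eq_integral_Ioo,
      ← intervalIntegral.integral_of_le (by linarith [Real.pi_pos]),
      integral_circDeriv (hE' r hr) hy hl hk]
  -- Two signs cancel: the bump decreases outwards by `1`, and the circles are run through
  -- clockwise.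
  rw [h3, integral_mul_const, integral_deriv_bumpProfile hR]
  ring

section Manifold

variable {S : Type*} [TopologicalSpace S] [ChartedSpace ℂ S]

/-- The circle-valued function `E` has winding number `k` on small circles around `ζ`, run through
in the negative sense. -/
def HasWinding (E : S → ℂ) (ζ : S) (k : ℝ) : Prop :=
  ∃ (σ₁ : ℝ) (y : ℝ × ℝ → ℝ), ContinuousOn y {c | σ₁ < c.1} ∧
    (∀ c : ℝ × ℝ, σ₁ < c.1 → E (CylTwist.endCoord ζ c) =
      Complex.exp (2 * Real.pi * y c * Complex.I)) ∧
    ∀ σ, σ₁ < σ → y (σ, 1) - y (σ, 0) = k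

/-- These bumps are the building blocks of `flux_eq_sum`: subtracting multiples of them removes the
constant values at the punctures, and each has a flux that is computed directly as a winding number.
-/
theorem exists_bump [T2Space S] [CompactSpace S] [IsManifold 𝓘(ℝ, ℂ) ∞ S]
    [IsManifold 𝓘(ℂ, ℂ) ω S] (p : ChartPartition S) (P : Finset S) {E : S → ℂ}
    (hE : ∀ z ∉ P, ContMDiffAt 𝓘(ℝ, ℂ) 𝓘(ℝ, ℂ) ∞ E z ∧ ∀ᶠ y in 𝓝 z, ‖E y‖ = 1)
    {ζ : S} (hζ : ζ ∈ P) {k : ℝ} (hk : HasWinding E ζ k) :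
    ∃ B : S → ℝ, Adapted B E ∧ B =ᶠ[𝓝 ζ] 1 ∧ (∀ ζ' ∈ P, ζ' ≠ ζ → B =ᶠ[𝓝 ζ'] 0) ∧
      flux p B E = k := by
  classical
  obtain ⟨σ₁, y, hyc, hyE, hyk⟩ := hk
  set e := chartAt ℂ ζ with he
  have hζs : ζ ∈ e.source := mem_chart_source ℂ ζ
  have hw₀ : e ζ ∈ e.target := e.map_source hζs
  have hU : {z | ∀ ζ' ∈ P, ζ' ≠ ζ → z ≠ ζ'} ∈ 𝓝 ζ := by
    have : {z | ∀ ζ' ∈ P, ζ' ≠ ζ → z ≠ ζ'} = (↑(P.erase ζ) : Set S)ᶜ := by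
      ext z
      simp only [mem_ofPred_eq, mem_compl_iff, Finset.mem_coe, Finset.mem_erase, not_and]
      exact ⟨fun h h1 h2 => h z h2 h1 rfl, fun h ζ' h1 h2 h3 => h (h3 ▸ h2) (h3 ▸ h1)⟩
    rw [this]
    exact (P.erase ζ).finite_toSet.isClosed.isOpen_compl.mem_nhds (by simp)
  -- The disc must lie in the chart, avoid the other punctures, and stay within the range `σ > σ₁`
  -- where the angular lift exists.
  have hU2 : e.target ∩ e.symm ⁻¹' {z | ∀ ζ' ∈ P, ζ' ≠ ζ → z ≠ ζ'} ∩
      Metric.ball (e ζ) (Real.exp (-(2 * Real.pi * σ₁))) ∈ 𝓝 (e ζ) := by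
    refine inter_mem (inter_mem (e.open_target.mem_nhds hw₀) ?_)
      (Metric.ball_mem_nhds _ (Real.exp_pos _))
    refine e.symm.continuousAt hw₀ ?_
    rwa [e.left_inv hζs]
  obtain ⟨R₀, hR₀, hball⟩ := Metric.nhds_basis_closedBall.mem_iff.1 hU2
  set R := R₀ / 2 with hRdef
  have hR : 0 < R := by positivity
  have hR2 : 2 * R = R₀ := by rw [hRdef]; ring
  set K : Set S := e.symm '' Metric.closedBall (e ζ) (2 * R) with hK
  have hballt : Metric.closedBall (e ζ) (2 * R) ⊆ e.target := fun w hw =>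
    (hball (hR2 ▸ hw)).1.1
  have hKc : IsCompact K := (isCompact_closedBall _ _).image_of_continuousOn
    (e.symm.continuousOn.mono hballt)
  have hKs : K ⊆ e.source := by
    rintro _ ⟨w, hw, rfl⟩
    exact e.map_target (hballt hw)
  set B : S → ℝ := indicator e.source (radialBump (e ζ) R ∘ e) with hB
  have hBsupp : tsupport B ⊆ K := by
    refine closure_minimal (fun z hz => ?_) hKc.isClosed
    rw [hB, Function.mem_support, indicator_apply_ne_zero] at hz
    refine ⟨e z, ?_, e.left_inv hz.1⟩
    rw [Metric.mem_closedBall, dist_eq_norm]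
    by_contra h
    exact hz.2 (radialBump_eq_zero hR (by linarith))
  have hBev : ∀ z ∈ e.source, B =ᶠ[𝓝 z] radialBump (e ζ) R ∘ e := fun z hz => by
    filter_upwards [e.open_source.mem_nhds hz] with x hx
    exact indicator_of_mem hx _
  have hBsmooth : ContMDiff 𝓘(ℝ, ℂ) 𝓘(ℝ, ℝ) ∞ B := by
    refine contMDiff_of_tsupport fun z hz => ?_
    have hzs := hKs (hBsupp hz)
    exact ((contDiff_radialBump (e ζ) R).contMDiff.contMDiffAt.comp z
      (contMDiffOn_chart.contMDiffAt (e.open_source.mem_nhds hzs))).congr_of_eventuallyEq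
      (hBev z hzs)
  have hB1 : B =ᶠ[𝓝 ζ] 1 := by
    have h1 : ∀ᶠ z in 𝓝 ζ, e z ∈ Metric.ball (e ζ) R :=
      (e.continuousAt hζs) (Metric.ball_mem_nhds _ hR)
    filter_upwards [hBev ζ hζs, h1] with z hz hz1
    rw [hz]
    exact radialBump_eq_one hR (by rw [← dist_eq_norm]; exact (Metric.mem_ball.1 hz1).le)
  have hB0 : ∀ ζ' ∈ P, ζ' ≠ ζ → B =ᶠ[𝓝 ζ'] 0 := by
    intro ζ' h1 h2
    refine notMem_tsupport_iff_eventuallyEq.1 fun h => ?_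
    obtain ⟨w, hw, hw2⟩ := hBsupp h
    exact (hball (hR2 ▸ hw)).1.2 ζ' h1 h2 hw2
  have hBad : Adapted B E := by
    intro z
    by_cases hz : z ∈ P
    · left
      by_cases hzζ : z = ζ
      · subst hzζ
        filter_upwards [hB1] with x hx
        rw [hx, hB1.self_of_nhds]; rfl
      · filter_upwards [hB0 z hz hzζ] with x hx
        rw [hx, (hB0 z hz hzζ).self_of_nhds]; rfl
    · exact .inr ⟨hBsmooth z, hE z hz⟩
  refine ⟨B, hBad, hB1, hB0, ?_⟩
  have hsub : tsupport B ⊆ (chartAt ℂ ζ).source := hBsupp.trans hKs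
  rw [flux_eq_of_tsupport_subset p hBad hsub, integral_chartJac_eq E hsub]
  have hext : chartExtend ζ B = radialBump (e ζ) R := by
    funext w
    by_cases hw : w ∈ e.target
    · rw [(chartExtend_eventuallyEq B hw).self_of_nhds, Function.comp_apply, hB,
        indicator_of_mem (e.map_target hw), Function.comp_apply, e.right_inv hw]
    · rw [chartExtend, indicator_of_notMem hw]
      refine (radialBump_eq_zero hR ?_).symm
      by_contra h
      exact hw (hballt (by rw [Metric.mem_closedBall, dist_eq_norm]; linarith))
  rw [hext]
  refine integral_jac_radialBump hR (fun w h1 h2 => ?_) fun r hr => ?_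
  · have hwb : w ∈ Metric.closedBall (e ζ) (2 * R) := by
      rwa [Metric.mem_closedBall, dist_eq_norm]
    refine contDiffAt_comp_chart_symm (hballt hwb) (hE _ fun h => ?_).1
    by_cases h3 : e.symm w = ζ
    · have h4 : e ζ = w := by rw [← h3]; exact e.right_inv (hballt hwb)
      rw [h4, sub_self, norm_zero] at h1
      linarith
    · exact (hball (hR2 ▸ hwb)).1.2 _ h h3 rfl
  · have hr0 : 0 < r := hR.trans_le hr.1
    -- Chosen so that `exp(-2πσ) = r`: the circle of radius `r` is the circle `σ = const` in
    -- `endCoord`.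
    set σ : ℝ := -(Real.log r / (2 * Real.pi)) with hσ
    have hpi := Real.pi_pos
    have hrexp : r < Real.exp (-(2 * Real.pi * σ₁)) := by
      have h1 : (e ζ + (2 * R : ℝ) : ℂ) ∈ Metric.closedBall (e ζ) R₀ := by
        rw [Metric.mem_closedBall, dist_eq_norm, add_sub_cancel_left, Complex.norm_real,
          Real.norm_of_nonneg (by positivity), hR2]
      have h2 := (hball h1).2
      rw [Metric.mem_ball, dist_eq_norm, add_sub_cancel_left, Complex.norm_real,
        Real.norm_of_nonneg (by positivity)] at h2
      linarith [hr.2]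
    have hσ1 : σ₁ < σ := by
      have h1 : Real.log r < -(2 * Real.pi * σ₁) := (Real.log_lt_iff_lt_exp hr0).2 hrexp
      have h2 : Real.log r / (2 * Real.pi) < -σ₁ := by
        rw [div_lt_iff₀ (by positivity)]; linarith
      rw [hσ]; linarith
    refine ⟨fun τ => y (σ, τ), ?_, fun τ => ?_, hyk σ hσ1⟩
    · exact hyc.comp_continuous (by fun_prop) fun τ => hσ1
    · have h1 := hyE (σ, τ) hσ1
      rw [← h1, CylTwist.endCoord, Function.comp_apply, polarPt]
      congr 3
      have h2 : (r : ℂ) = Complex.exp (-(2 * Real.pi * σ)) := by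
        have h3 : r = Real.exp (-(2 * Real.pi * σ)) := by
          rw [hσ]
          have : -(2 * Real.pi * -(Real.log r / (2 * Real.pi))) = Real.log r := by field_simp
          rw [this, Real.exp_log hr0]
        rw [h3]; push_cast; rfl
      rw [h2, ← Complex.exp_add]
      congr 1
      push_cast
      ring

/-- Stokes' theorem for `d(f · d(arg E))` on a compact Riemann surface with punctures at which `f`
is locally constant. -/
theorem flux_eq_sum [T2Space S] [CompactSpace S] [IsManifold 𝓘(ℝ, ℂ) ∞ S]
    [IsManifold 𝓘(ℂ, ℂ) ω S] (p : ChartPartition S) (P : Finset S) {f : S → ℝ} {E : S → ℂ}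
    {c k : S → ℝ} (h : ∀ z ∉ P, SmoothPair f E z) (hc : ∀ ζ ∈ P, f =ᶠ[𝓝 ζ] fun _ => c ζ)
    (hk : ∀ ζ ∈ P, HasWinding E ζ (k ζ)) : flux p f E = ∑ ζ ∈ P, c ζ * k ζ := by
  classical
  choose! B hBa hB1 hB0 hBf using fun ζ (hζ : ζ ∈ P) =>
    exists_bump p P (fun z hz => (h z hz).2) hζ (hk ζ hζ)
  -- `H` agrees with `f` near every puncture, so `f - H` has zero flux by `flux_eq_zero`, and the
  -- flux of `H` is a combination of winding numbers.
  set H : S → ℝ := fun z => ∑ ζ ∈ P, c ζ * B ζ z with hH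
  have hHa : Adapted H E := Adapted.sum P fun ζ hζ => (hBa ζ hζ).const_mul _
  have hg : ∀ z, (fun x => f x + (-1) * H x) =ᶠ[𝓝 z] 0 ∨
      SmoothPair (fun x => f x + (-1) * H x) E z := by
    intro z
    by_cases hz : z ∈ P
    · left
      have h1 : ∀ᶠ x in 𝓝 z, ∀ ζ ∈ P, ζ ≠ z → B ζ x = 0 := by
        rw [Filter.eventually_all_finset]
        intro ζ hζ
        by_cases hne : ζ = z
        · exact Eventually.of_forall fun _ h => absurd hne h
        · exact (hB0 ζ hζ z hz fun h => hne h.symm).mono fun x hx _ => hx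
      filter_upwards [h1, hB1 z hz, hc z hz] with x hx1 hx2 hx3
      have h2 : H x = c z := by
        simp only [hH]
        rw [Finset.sum_eq_single z (fun ζ hζ hne => by rw [hx1 ζ hζ hne, mul_zero])
          (fun h => absurd hz h), hx2]
        simp
      rw [h2, hx3]; simp
    · exact .inr ⟨(h z hz).1.add (contMDiffAt_const.mul (hHa.contMDiff z)), (h z hz).2⟩
  have hga : Adapted (fun x => f x + (-1) * H x) E := fun z => (hg z).imp_left fun h0 => by
    filter_upwards [h0] with x hx
    exact hx.trans h0.self_of_nhds.symm
  have hf : f = fun x => (f x + (-1) * H x) + H x := by funext x; ring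
  rw [hf, flux_add p hga hHa, flux_eq_zero p hg, zero_add, hH,
    flux_sum p P fun ζ hζ => (hBa ζ hζ).const_mul _]
  refine Finset.sum_congr rfl fun ζ hζ => ?_
  rw [flux_const_mul p _ (hBa ζ hζ), hBf ζ hζ]

end Manifold

end SurfaceFlux

/-! ### Dynamics of the perturbed twist across an unperturbed strip. -/

namespace CylTwist

variable {Q : ℕ} {X₁ X₂ ε : ℝ}

theorem contDiff_zpow (F : PerturbedTwist Q X₁ X₂ ε) (n : ℤ) : ContDiff ℝ ∞ ⇑(F.φ ^ n) := by
  induction n with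
  | zero => exact contDiff_id
  | succ n ih => rw [zpow_add_one, Equiv.Perm.coe_mul]; exact ih.comp F.smooth
  | pred n ih => rw [zpow_sub_one, Equiv.Perm.coe_mul]; exact ih.comp F.smooth_symm

theorem zpow_iterate_apply (F : PerturbedTwist Q X₁ X₂ ε) {q : ℕ} {p : ℤ} {z : ℝ × ℝ}
    (h : F.φ^[q] z = z - (0, (p : ℝ))) (m : ℕ) :
    (F.φ ^ ((m : ℤ) * q)) z = z - (0, ((m * p : ℤ) : ℝ)) := by
  have hq : (F.φ ^ (q : ℤ)) z = z + (0, ((-p : ℤ) : ℝ)) := by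
    rw [zpow_natCast, ← Equiv.Perm.iterate_eq_pow, h]
    ext <;> simp [sub_eq_add_neg]
  induction m with
  | zero => ext <;> simp
  | succ m ih =>
    have h1 : (((m + 1 : ℕ) : ℤ) * q) = m * q + q := by push_cast; ring
    rw [h1, zpow_add, Equiv.Perm.mul_apply, hq, zpow_shift_int, ih]
    ext
    · simp
    · simp; ring

theorem zpow_neg_iterate_apply (F : PerturbedTwist Q X₁ X₂ ε) {q : ℕ} {p : ℤ} {z : ℝ × ℝ}
    (h : F.φ^[q] z = z - (0, (p : ℝ))) (m : ℕ) :
    (F.φ ^ (-((m : ℤ) * q))) z = z + (0, ((m * p : ℤ) : ℝ)) := by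
  have h1 := zpow_iterate_apply F h m
  have h2 : (F.φ ^ (-((m : ℤ) * q))) (z - (0, ((m * p : ℤ) : ℝ))) = z := by
    rw [← h1, zpow_neg]
    exact Equiv.symm_apply_apply _ _
  have h3 : z - (0, ((m * p : ℤ) : ℝ)) = z + (0, ((-(m * p) : ℤ) : ℝ)) := by
    ext
    · simp
    · push_cast; simp; ring
  rw [h3, zpow_shift_int] at h2
  nth_rewrite 2 [← h2]
  ext
  · simp
  · push_cast; simp

/-- The perturbed map is the twist over `[a,b]`. -/
def IsTwistOn (F : PerturbedTwist Q X₁ X₂ ε) (a b : ℝ) : Prop :=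
  ∀ z : ℝ × ℝ, a ≤ z.1 → z.1 ≤ b → F.φ z = twist z

/-- The circle `x = c` is mapped onto itself, so by injectivity no other point can land on it. -/
theorem IsTwistOn.ne_of_notMem {F : PerturbedTwist Q X₁ X₂ ε} {a b c : ℝ} (h : IsTwistOn F a b)
    (hc : c ∈ Icc a b) {z : ℝ × ℝ} (hz : z.1 ≠ c) : (F.φ z).1 ≠ c := by
  intro h1
  have h2 : F.φ (c, (F.φ z).2 + c) = F.φ z := by
    rw [h _ hc.1 hc.2]
    ext <;> simp [twist, h1]
  exact hz (by rw [← F.φ.injective h2])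

/-- The image of the connected half-plane `x < a` never meets `x = a`, so it stays on one side; a
point beyond the boundary, where the map is the twist, decides which. -/
theorem IsTwistOn.fst_lt {F : PerturbedTwist Q X₁ X₂ ε} {a b : ℝ} (h : IsTwistOn F a b)
    (hab : a ≤ b) {z : ℝ × ℝ} (hz : z.1 < a) : (F.φ z).1 < a := by
  by_contra! hcon
  obtain ⟨δ, -, hδ⟩ := F.near_boundary
  set z' : ℝ × ℝ := (min (a - 1) (X₁ + δ), 0) with hz'
  have h1 : (F.φ z').1 < a := by
    rw [hδ z' (.inl (min_le_right _ _))]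
    exact (min_le_left _ _).trans_lt (by linarith)
  have hconv : IsPreconnected {z : ℝ × ℝ | z.1 < a} :=
    ((convex_Iio a).linear_preimage (LinearMap.fst ℝ ℝ ℝ)).isPreconnected
  have hcont : ContinuousOn (fun z => (F.φ z).1) {z : ℝ × ℝ | z.1 < a} :=
    (continuous_fst.comp F.smooth.continuous).continuousOn
  obtain ⟨w, hw, hw2⟩ := hconv.intermediate_value (a := z') (b := z)
    (show z'.1 < a from (min_le_left _ _).trans_lt (by linarith)) hz hcont ⟨h1.le, hcon⟩
  exact h.ne_of_notMem ⟨le_rfl, hab⟩ (ne_of_lt hw) hw2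

theorem IsTwistOn.lt_fst {F : PerturbedTwist Q X₁ X₂ ε} {a b : ℝ} (h : IsTwistOn F a b)
    (hab : a ≤ b) {z : ℝ × ℝ} (hz : b < z.1) : b < (F.φ z).1 := by
  by_contra! hcon
  obtain ⟨δ, -, hδ⟩ := F.near_boundary
  set z' : ℝ × ℝ := (max (b + 1) (X₂ - δ), 0) with hz'
  have hbz' : b < z'.1 := (by linarith : b < b + 1).trans_le (le_max_left _ _)
  have h1 : b < (F.φ z').1 := by
    rw [hδ z' (.inr (le_max_right _ _))]
    exact hbz'
  have hconv : IsPreconnected {z : ℝ × ℝ | b < z.1} :=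
    ((convex_Ioi b).linear_preimage (LinearMap.fst ℝ ℝ ℝ)).isPreconnected
  have hcont : ContinuousOn (fun z => (F.φ z).1) {z : ℝ × ℝ | b < z.1} :=
    (continuous_fst.comp F.smooth.continuous).continuousOn
  obtain ⟨w, hw, hw2⟩ := hconv.intermediate_value (a := z) (b := z') hz hbz' hcont ⟨hcon, h1.le⟩
  exact h.ne_of_notMem ⟨hab, le_rfl⟩ (ne_of_gt hw) hw2

/-- A function of `x` which is constant on both sides of the strip `[a,b]`. -/
def IsConstOff (g : ℝ → ℝ) (a b : ℝ) : Prop :=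
  (∀ x y, x ≤ a → y ≤ a → g x = g y) ∧ ∀ x y, b ≤ x → b ≤ y → g x = g y

/-- Either side of the strip is preserved, and on the strip the twist fixes `x`. This is what lets
such functions of `x` descend to the mapping torus. -/
theorem IsTwistOn.map_eq {F : PerturbedTwist Q X₁ X₂ ε} {a b : ℝ} (h : IsTwistOn F a b)
    (hab : a ≤ b) {g : ℝ → ℝ} (hg : IsConstOff g a b) (z : ℝ × ℝ) : g (F.φ z).1 = g z.1 := by
  rcases lt_or_ge z.1 a with h1 | h1
  · exact hg.1 _ _ (h.fst_lt hab h1).le h1.le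
  rcases lt_or_ge b z.1 with h2 | h2
  · exact hg.2 _ _ (h.lt_fst hab h2).le h2.le
  · rw [h z h1 h2]; rfl

theorem IsTwistOn.zpow_eq {F : PerturbedTwist Q X₁ X₂ ε} {a b : ℝ} (h : IsTwistOn F a b)
    (hab : a ≤ b) {g : ℝ → ℝ} (hg : IsConstOff g a b) (n : ℤ) (z : ℝ × ℝ) :
    g ((F.φ ^ n) z).1 = g z.1 := by
  induction n generalizing z with
  | zero => rfl
  | succ n ih => rw [zpow_add_one, Equiv.Perm.mul_apply, ih, h.map_eq hab hg]
  | pred n ih =>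
    have h1 : F.φ (F.φ⁻¹ z) = z := Equiv.apply_symm_apply _ _
    rw [zpow_sub_one, Equiv.Perm.mul_apply, ih, ← h.map_eq hab hg (F.φ⁻¹ z), h1]

theorem IsTwistOn.zpow_apply {F : PerturbedTwist Q X₁ X₂ ε} {a b : ℝ} (h : IsTwistOn F a b)
    (n : ℤ) {z : ℝ × ℝ} (h1 : a ≤ z.1) (h2 : z.1 ≤ b) :
    (F.φ ^ n) z = (z.1, z.2 - n * z.1) := by
  induction n generalizing z with
  | zero => simp
  | succ n ih =>
    rw [zpow_add_one, Equiv.Perm.mul_apply, h z h1 h2, ih (z := twist z) h1 h2]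
    ext
    · rfl
    · simp [twist]; ring
  | pred n ih =>
    have h3 : F.φ⁻¹ z = (z.1, z.2 + z.1) := by
      rw [Equiv.Perm.inv_eq_iff_eq, h (z.1, z.2 + z.1) h1 h2]
      ext <;> simp [twist]
    rw [zpow_sub_one, Equiv.Perm.mul_apply, h3, ih (z := (z.1, z.2 + z.1)) h1 h2]
    ext
    · rfl
    · simp; ring

/-! ### Coordinates on the mapping torus -/

/-- A smooth step from `0` to `1` which is constant near the integers. -/
noncomputable def unitStep (t : ℝ) : ℝ := Real.smoothTransition (3 * t - 1)

theorem contDiff_unitStep : ContDiff ℝ ∞ unitStep :=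
  Real.smoothTransition.contDiff.comp ((contDiff_const.mul contDiff_id).sub contDiff_const)

/-- A smooth reparametrization of the flow coordinate which is constant near the integers. -/
noncomputable def timeCoord (t : ℝ) : ℝ := ⌊t⌋ + unitStep (Int.fract t)

/-- A function on the cover that is equivariant under the deck transformations and extends the
coordinate `y` on the slice `t = 0`. -/
noncomputable def angleCoord (F : PerturbedTwist Q X₁ X₂ ε) (a : ℝ × (ℝ × ℝ)) : ℝ :=
  (1 - unitStep (Int.fract a.1)) * ((F.φ ^ ⌊a.1⌋) a.2).2 +
    unitStep (Int.fract a.1) * ((F.φ ^ (⌊a.1⌋ + 1)) a.2).2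

theorem timeCoord_sub_int (t : ℝ) (n : ℤ) : timeCoord (t - n) = timeCoord t - n := by
  simp [timeCoord]; ring

/-- The interpolated quantities are the `y`-coordinates at which the flow line through `(t, z)`
meets the two neighbouring integer slices. They depend on the flow line alone, up to integer
translation. -/
theorem angleCoord_deck (F : PerturbedTwist Q X₁ X₂ ε) (t : ℝ) (z : ℝ × ℝ) (n k : ℤ) :
    angleCoord F (t - n, (F.φ ^ n) z + (0, (k : ℝ))) = angleCoord F (t, z) + k := by
  have h : ∀ m : ℤ, (F.φ ^ (m - n)) ((F.φ ^ n) z) = (F.φ ^ m) z := fun m => by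
    rw [← Equiv.Perm.mul_apply, ← zpow_add, sub_add_cancel]
  have h2 : ⌊t⌋ - n + 1 = (⌊t⌋ + 1) - n := by ring
  simp only [angleCoord, Int.floor_sub_intCast, Int.fract_sub_intCast, zpow_shift_int, h, h2]
  simp; ring

/-- The interpolated values are `y - nx` and `y - (n+1)x`. Using the same weights in `timeCoord`
makes the formula exact, which the cancellation in `density_nonneg` needs. -/
theorem angleCoord_eq {F : PerturbedTwist Q X₁ X₂ ε} {a b : ℝ} (h : IsTwistOn F a b) (t : ℝ)
    {z : ℝ × ℝ} (h1 : a ≤ z.1) (h2 : z.1 ≤ b) :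
    angleCoord F (t, z) = z.2 - timeCoord t * z.1 := by
  simp only [angleCoord, timeCoord, h.zpow_apply _ h1 h2]
  push_cast
  ring

/-- This gives smoothness across integers: just below `n` the step of the previous interval has
reached `1` and that of the next is still `0`, so the two formulas agree. -/
theorem floor_eq_or {t : ℝ} {n : ℤ} (h1 : (n : ℝ) - 1 / 3 < t) (h2 : t < n + 1) :
    (⌊t⌋ = n ∧ Int.fract t = t - n) ∨
      (⌊t⌋ = n - 1 ∧ unitStep (Int.fract t) = 1 ∧ unitStep (t - n) = 0) := by
  rcases le_or_gt (n : ℝ) t with h | h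
  · have hf : ⌊t⌋ = n := Int.floor_eq_iff.2 ⟨h, h2⟩
    exact .inl ⟨hf, by rw [Int.fract, hf]⟩
  · have hf : ⌊t⌋ = n - 1 := Int.floor_eq_iff.2 ⟨by push_cast; linarith, by push_cast; linarith⟩
    refine .inr ⟨hf, Real.smoothTransition.one_of_one_le ?_,
      Real.smoothTransition.zero_of_nonpos ?_⟩
    · rw [Int.fract, hf]; push_cast; linarith
    · linarith

theorem eventually_near_floor (t : ℝ) : ∀ᶠ s in 𝓝 t, (⌊t⌋ : ℝ) - 1 / 3 < s ∧ s < ⌊t⌋ + 1 :=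
  Ioo_mem_nhds (by linarith [Int.floor_le t]) (Int.lt_floor_add_one t)

theorem contDiff_timeCoord : ContDiff ℝ ∞ timeCoord := by
  refine contDiff_iff_contDiffAt.2 fun t => ?_
  have h : timeCoord =ᶠ[𝓝 t] fun s => ⌊t⌋ + unitStep (s - ⌊t⌋) := by
    filter_upwards [eventually_near_floor t] with s hs
    rcases floor_eq_or hs.1 hs.2 with ⟨h1, h2⟩ | ⟨h1, h2, h3⟩
    · rw [timeCoord, h1, h2]
    · rw [timeCoord, h1, h2, h3]; push_cast; ring
  refine ContDiffAt.congr_of_eventuallyEq ?_ h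
  exact (contDiff_const.add
    (contDiff_unitStep.comp (contDiff_id.sub contDiff_const))).contDiffAt

theorem contDiff_angleCoord (F : PerturbedTwist Q X₁ X₂ ε) : ContDiff ℝ ∞ (angleCoord F) := by
  refine contDiff_iff_contDiffAt.2 fun a => ?_
  have h : angleCoord F =ᶠ[𝓝 a] fun c => (1 - unitStep (c.1 - ⌊a.1⌋)) * ((F.φ ^ ⌊a.1⌋) c.2).2 +
      unitStep (c.1 - ⌊a.1⌋) * ((F.φ ^ (⌊a.1⌋ + 1)) c.2).2 := by
    filter_upwards [continuous_fst.continuousAt.eventually (eventually_near_floor a.1)] with c hc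
    rcases floor_eq_or hc.1 hc.2 with ⟨h1, h2⟩ | ⟨h1, h2, h3⟩
    · rw [angleCoord, h1, h2]
    · rw [angleCoord, h1, h2, h3]; simp
  refine ContDiffAt.congr_of_eventuallyEq ?_ h
  have h1 : ContDiff ℝ ∞ fun c : ℝ × (ℝ × ℝ) => unitStep (c.1 - ⌊a.1⌋) :=
    contDiff_unitStep.comp (contDiff_fst.sub contDiff_const)
  have h2 : ∀ n : ℤ, ContDiff ℝ ∞ fun c : ℝ × (ℝ × ℝ) => ((F.φ ^ n) c.2).2 := fun n =>
    contDiff_snd.comp ((contDiff_zpow F n).comp contDiff_snd)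
  exact (((contDiff_const.sub h1).mul (h2 _)).add (h1.mul (h2 _))).contDiffAt

theorem cexp_add_int (y : ℝ) (k : ℤ) :
    Complex.exp (2 * Real.pi * ((y + k : ℝ) : ℂ) * Complex.I) =
      Complex.exp (2 * Real.pi * y * Complex.I) :=
  Complex.exp_eq_exp_iff_exists_int.2 ⟨k, by push_cast; ring⟩

/-- The circle-valued function on the mapping torus defined by `angleCoord`. -/
noncomputable def angleFun (F : PerturbedTwist Q X₁ X₂ ε) : MappingTorus F → ℂ :=
  Quotient.lift (fun a : Cov X₁ X₂ =>
    Complex.exp (2 * Real.pi * angleCoord F (a.1, (a.2 : ℝ × ℝ)) * Complex.I)) (by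
      rintro a b ⟨n, k, h1, h2⟩
      simp only [h1, h2, angleCoord_deck, cexp_add_int])

/-- The circle-valued function on the mapping torus defined by `timeCoord`. -/
noncomputable def timeFun (F : PerturbedTwist Q X₁ X₂ ε) : MappingTorus F → ℂ :=
  Quotient.lift (fun a : Cov X₁ X₂ =>
    Complex.exp (2 * Real.pi * timeCoord a.1 * Complex.I)) (by
      rintro a b ⟨n, k, h1, h2⟩
      have h3 := cexp_add_int (timeCoord b.1) n
      rw [h1, timeCoord_sub_int, sub_add_cancel] at h3
      simp only [h1, timeCoord_sub_int]
      exact h3)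

/-- The function on the mapping torus defined by a function of `x`. -/
noncomputable def fstFun {F : PerturbedTwist Q X₁ X₂ ε} {a b : ℝ} (h : IsTwistOn F a b)
    (hab : a ≤ b) {g : ℝ → ℝ} (hg : IsConstOff g a b) : MappingTorus F → ℝ :=
  Quotient.lift (fun c : Cov X₁ X₂ => g (c.2 : ℝ × ℝ).1) (by
      rintro c d ⟨n, k, h1, h2⟩
      have h3 : (d.2 : ℝ × ℝ).1 = ((F.φ ^ n) (c.2 : ℝ × ℝ)).1 := by rw [h2]; simp
      simp only [h3]
      exact (h.zpow_eq hab hg n _).symm)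

/-- A smooth step function across the strip `[a,b]`, with a potential for `x` times its
derivative. -/
theorem exists_step {a b : ℝ} (hab : a < b) : ∃ (G K : ℝ → ℝ) (c : ℝ), c ∈ Icc a b ∧
    ContDiff ℝ ∞ G ∧ ContDiff ℝ ∞ K ∧ (∀ x, 0 ≤ deriv G x) ∧ (∀ x, deriv K x = x * deriv G x) ∧
    (∀ x ∉ Ioo a b, deriv G x = 0) ∧ (∀ x ≤ a, G x = -1 ∧ K x = -c) ∧
    ∀ x, b ≤ x → G x = 0 ∧ K x = 0 := by
  have hba : 0 < b - a := sub_pos.2 hab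
  set G : ℝ → ℝ := fun x => Real.smoothTransition ((x - a) / (b - a)) - 1 with hG
  have hGs : ContDiff ℝ ∞ G := (Real.smoothTransition.contDiff.comp
    ((contDiff_id.sub contDiff_const).div_const _)).sub contDiff_const
  have hGa : ∀ x ≤ a, G x = -1 := fun x hx => by
    simp only [hG]
    rw [Real.smoothTransition.zero_of_nonpos (div_nonpos_of_nonpos_of_nonneg (by linarith) hba.le)]
    norm_num
  have hGb : ∀ x, b ≤ x → G x = 0 := fun x hx => by
    simp only [hG]
    rw [Real.smoothTransition.one_of_one_le ((one_le_div hba).2 (by linarith))]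
    norm_num
  have hG0 : ∀ x, G x ≤ 0 := fun x => by
    simp only [hG]; linarith [Real.smoothTransition.le_one ((x - a) / (b - a))]
  have hG1 : ∀ x, -1 ≤ G x := fun x => by
    simp only [hG]; linarith [Real.smoothTransition.nonneg ((x - a) / (b - a))]
  have hmono : Monotone G := fun x y hxy => by
    simp only [hG]
    have := Real.smoothTransition.monotone
      (show (x - a) / (b - a) ≤ (y - a) / (b - a) by gcongr)
    linarith
  set M : ℝ → ℝ := fun x => ∫ s in b..x, G s with hM
  have hMd : ∀ x, HasDerivAt M (G x) x := fun x =>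
    intervalIntegral.integral_hasDerivAt_right (hGs.continuous.intervalIntegrable _ _)
      hGs.continuous.stronglyMeasurable.stronglyMeasurableAtFilter hGs.continuous.continuousAt
  have hMs : ContDiff ℝ ∞ M := by
    refine contDiff_infty_iff_deriv.2 ⟨fun x => (hMd x).differentiableAt, ?_⟩
    have : deriv M = G := funext fun x => (hMd x).deriv
    rwa [this]
  have hGi : ∀ u v, IntervalIntegrable G MeasureTheory.volume u v := fun u v =>
    hGs.continuous.intervalIntegrable u v
  have hint : -(b - a) ≤ ∫ s in a..b, G s ∧ ∫ s in a..b, G s ≤ 0 := by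
    constructor
    · have := intervalIntegral.integral_mono_on hab.le
        (intervalIntegrable_const (c := (-1 : ℝ)) (μ := MeasureTheory.volume)) (hGi a b)
        fun x _ => hG1 x
      simpa using this
    · have := intervalIntegral.integral_mono_on hab.le (hGi a b)
        (intervalIntegrable_const (c := (0 : ℝ)) (μ := MeasureTheory.volume))
        fun x _ => hG0 x
      simpa using this
  -- Integration by parts: `K` is the primitive of `x G'` vanishing at `b`, and `c` is the integral
  -- of `x G'` over `[a,b]`. It is an average of `x`, as `G'` has total mass `1`.
  refine ⟨G, fun x => x * G x - M x, a - ∫ s in a..b, G s, ⟨by linarith, by linarith⟩, hGs,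
    (contDiff_id.mul hGs).sub hMs, fun x => hmono.deriv_nonneg, fun x => ?_, fun x hx => ?_,
    fun x hx => ⟨hGa x hx, ?_⟩, fun x hx => ⟨hGb x hx, ?_⟩⟩
  · have h1 := ((hasDerivAt_id x).mul
      (hGs.differentiable (by simp) x).hasDerivAt).sub (hMd x)
    have h2 : deriv (fun x => x * G x - M x) x = _ := h1.deriv
    rw [h2]; simp
  · rw [mem_Ioo, not_and_or, not_lt, not_lt] at hx
    rcases hx with hx | hx
    · exact IsLocalMin.deriv_eq_zero (Eventually.of_forall fun y => by rw [hGa x hx]; exact hG1 y)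
    · exact IsLocalMax.deriv_eq_zero (Eventually.of_forall fun y => by rw [hGb x hx]; exact hG0 y)
  · have h1 : M x = (∫ s in b..a, G s) + ∫ s in a..x, G s :=
      (intervalIntegral.integral_add_adjacent_intervals (hGi _ _) (hGi _ _)).symm
    have h2 : ∫ s in a..x, G s = ∫ s in a..x, (-1 : ℝ) :=
      intervalIntegral.integral_congr fun s hs => hGa s (by
        rw [uIcc_of_ge hx] at hs; exact hs.2)
    rw [h2, intervalIntegral.integral_symm] at h1
    simp only [h1, hGa x hx]
    simp
    ring
  · have h1 : M x = ∫ s in b..x, (0 : ℝ) :=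
      intervalIntegral.integral_congr fun s hs => hGb s (by
        rw [uIcc_of_le hx] at hs; exact hs.1)
    simp [h1, hGb x hx]

end CylTwist

/-! ### The flux of a holomorphic curve through a strip. -/

namespace CylTwist

open SurfaceFlux

variable {Q : ℕ} {X₁ X₂ ε : ℝ}

/-- The form `ω` is nonnegative on complex lines. -/
theorem AdmissibleJ.area_nonneg {F : PerturbedTwist Q X₁ X₂ ε} (J : AdmissibleJ F)
    {a : ℝ × (ℝ × ℝ)} (ha : a.2.1 ∈ Icc X₁ X₂) (v : Tan) :
    0 ≤ v.2.2.1 * (J.J a v).2.2.2 - v.2.2.2 * (J.J a v).2.2.1 := by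
  have h1 : J.J a (0, 1, 0) = (-1, 0, 0) := by
    rw [← J.map_s a ha, J.sq a ha]
    ext <;> simp
  have h2 : v = v.1 • ((1, 0, 0) : Tan) + v.2.1 • ((0, 1, 0) : Tan) + (0, 0, v.2.2) := by
    ext <;> simp
  -- `J` preserves the plane of `∂/∂s` and `∂/∂t`, so the `(x,y)`-part of `J v` depends only on that
  -- of `v`. For a vector without `s`- and `t`-parts, `Ω(v, Jv)` reduces to `ω(v, Jv)`.
  have h3 : (J.J a v).2.2 = (J.J a (0, 0, v.2.2)).2.2 := by
    conv_lhs => rw [h2]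
    rw [map_add, map_add, map_smul, map_smul, h1, J.map_s a ha]
    simp
  rw [h3]
  by_cases h4 : ((0, 0, v.2.2) : Tan) = 0
  · have h5 : v.2.2 = 0 := by simpa using h4
    simp [h5]
  · have h5 := J.tamed a ha _ h4
    simp only [Omega] at h5
    linarith

theorem sum_ends_eq {ι : Type*} {P : Finset ι} {orbit : ι → OrbitLabel} {mult : ι → ℕ}
    {α : Multiset OrbitLabel} (hpos : ∀ ζ ∈ P, 0 < mult ζ)
    (htot : ∀ γ, ∑ ζ ∈ P with orbit ζ = γ, mult ζ = α.count γ) (w : OrbitLabel → ℝ) :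
    ∑ ζ ∈ P, mult ζ * w (orbit ζ) = (α.map w).sum := by
  classical
  have hmem : ∀ ζ ∈ P, orbit ζ ∈ α.toFinset := by
    intro ζ hζ
    rw [Multiset.mem_toFinset, ← Multiset.count_pos, ← htot]
    exact (hpos ζ hζ).trans_le (Finset.single_le_sum (f := mult) (fun _ _ => Nat.zero_le _)
      (Finset.mem_filter.2 ⟨hζ, rfl⟩))
  rw [← Finset.sum_fiberwise_of_maps_to hmem, Finset.sum_multiset_map_count]
  refine Finset.sum_congr rfl fun γ _ => ?_
  rw [nsmul_eq_mul, ← htot γ, Nat.cast_sum, Finset.sum_mul]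
  exact Finset.sum_congr rfl fun ζ hζ => by rw [(Finset.mem_filter.1 hζ).2]

theorem mem_of_end {ι : Type*} {P : Finset ι} {orbit : ι → OrbitLabel} {mult : ι → ℕ}
    {α : Multiset OrbitLabel} (hpos : ∀ ζ ∈ P, 0 < mult ζ)
    (htot : ∀ γ, ∑ ζ ∈ P with orbit ζ = γ, mult ζ = α.count γ) {ζ : ι} (hζ : ζ ∈ P) :
    orbit ζ ∈ α := by
  classical
  rw [← Multiset.count_pos, ← htot]
  exact (hpos ζ hζ).trans_le (Finset.single_le_sum (f := mult) (fun _ _ => Nat.zero_le _)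
    (Finset.mem_filter.2 ⟨hζ, rfl⟩))

section Curves

variable {S : Type*} [TopologicalSpace S] [ChartedSpace ℂ S]

theorem contMDiffAt_of_comp_chart_symm [IsManifold 𝓘(ℝ, ℂ) ∞ S] {V : Type*}
    [NormedAddCommGroup V] [NormedSpace ℝ V] {f : S → V} {z : S}
    (h : ContDiffAt ℝ ∞ (f ∘ (chartAt ℂ z).symm) (chartAt ℂ z z)) :
    ContMDiffAt 𝓘(ℝ, ℂ) 𝓘(ℝ, V) ∞ f z := by
  have h1 := h.contMDiffAt.comp z (contMDiffOn_chart.contMDiffAt (chart_source_mem_nhds ℂ z))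
  refine h1.congr_of_eventuallyEq ?_
  filter_upwards [chart_source_mem_nhds ℂ z] with x hx
  simp [(chartAt ℂ z).left_inv hx]

theorem IsHolomorphicLift.comp_eventuallyEq {F : PerturbedTwist Q X₁ X₂ ε} {J : AdmissibleJ F}
    {u : S → ℝ × MappingTorus F} {z : S} {f : ℂ → ℝ × Cov X₁ X₂}
    (hf : IsHolomorphicLift F J u z f) {V : Type*} {m : MappingTorus F → V}
    {h : ℝ × (ℝ × ℝ) → V} (hm : ∀ c : Cov X₁ X₂, m (proj F c) = h (c.1, (c.2 : ℝ × ℝ))) :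
    (fun p => m (u p).2) ∘ (chartAt ℂ z).symm =ᶠ[𝓝 (chartAt ℂ z z)]
      fun w => h (toTan (f w)).2 := by
  filter_upwards [hf.2] with w hw
  simp only [Function.comp_apply, ← hw.1, hm]
  rfl

theorem IsHolomorphicAt.contMDiffAt_comp [IsManifold 𝓘(ℝ, ℂ) ∞ S]
    {F : PerturbedTwist Q X₁ X₂ ε} {J : AdmissibleJ F} {u : S → ℝ × MappingTorus F} {z : S}
    (hu : IsHolomorphicAt F J u z) {V : Type*} [NormedAddCommGroup V] [NormedSpace ℝ V]
    {m : MappingTorus F → V} {h : ℝ × (ℝ × ℝ) → V}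
    (hm : ∀ c : Cov X₁ X₂, m (proj F c) = h (c.1, (c.2 : ℝ × ℝ))) (hh : ContDiff ℝ ∞ h) :
    ContMDiffAt 𝓘(ℝ, ℂ) 𝓘(ℝ, V) ∞ (fun p => m (u p).2) z := by
  obtain ⟨f, hf⟩ := hu
  refine contMDiffAt_of_comp_chart_symm (ContDiffAt.congr_of_eventuallyEq ?_
    (hf.comp_eventuallyEq hm))
  exact hh.contDiffAt.comp (chartAt ℂ z z) (contDiff_snd.contDiffAt.comp _ hf.1)

theorem norm_exp_two_pi (y : ℝ) : ‖Complex.exp (2 * Real.pi * y * Complex.I)‖ = 1 := by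
  have : (2 * Real.pi * y * Complex.I : ℂ) = ((2 * Real.pi * y : ℝ) : ℂ) * Complex.I := by
    push_cast; ring
  rw [this, Complex.norm_exp_ofReal_mul_I]

theorem norm_angleFun (F : PerturbedTwist Q X₁ X₂ ε) (q : MappingTorus F) :
    ‖angleFun F q‖ = 1 := by
  induction q using Quotient.inductionOn with
  | h a => exact norm_exp_two_pi _

theorem norm_timeFun (F : PerturbedTwist Q X₁ X₂ ε) (q : MappingTorus F) :
    ‖timeFun F q‖ = 1 := by
  induction q using Quotient.inductionOn with
  | h a => exact norm_exp_two_pi _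

theorem contDiff_exp_two_pi {V : Type*} [NormedAddCommGroup V] [NormedSpace ℝ V] {y : V → ℝ}
    (hy : ContDiff ℝ ∞ y) :
    ContDiff ℝ ∞ fun v => Complex.exp (2 * Real.pi * y v * Complex.I) :=
  Complex.contDiff_exp.comp ((contDiff_const.mul (Complex.ofRealCLM.contDiff.comp hy)).mul
    contDiff_const)

/-- On the strip `dG ∧ d(y - Tx) + x G' dx ∧ dT = G' dx ∧ dy`, because the terms in `dx ∧ dT`
cancel; then `AdmissibleJ.area_nonneg` applies. Off the strip both densities vanish, so no formula
for `angleCoord` is needed there. -/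
theorem density_nonneg {F : PerturbedTwist Q X₁ X₂ ε} {J : AdmissibleJ F} {a b : ℝ}
    (h : IsTwistOn F a b) (hab : a ≤ b) {G K : ℝ → ℝ} (hG : ContDiff ℝ ∞ G)
    (hK : ContDiff ℝ ∞ K) (hGn : ∀ x, 0 ≤ deriv G x) (hKd : ∀ x, deriv K x = x * deriv G x)
    (hG0 : ∀ x ∉ Ioo a b, deriv G x = 0) (hGc : IsConstOff G a b) (hKc : IsConstOff K a b)
    {u : S → ℝ × MappingTorus F} {z : S} (hu : IsHolomorphicAt F J u z) :
    0 ≤ chartJac z (fun p => fstFun h hab hGc (u p).2) (fun p => angleFun F (u p).2)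
        (chartAt ℂ z z) +
      chartJac z (fun p => fstFun h hab hKc (u p).2) (fun p => timeFun F (u p).2)
        (chartAt ℂ z z) := by
  obtain ⟨f, hf⟩ := hu
  set w₀ := chartAt ℂ z z
  set p : ℂ → Tan := fun w => toTan (f w) with hp
  have hpd : HasFDerivAt p (fderiv ℝ p w₀) w₀ := (hf.1.differentiableAt (by simp)).hasFDerivAt
  set D := fderiv ℝ p w₀
  have ht : HasFDerivAt (fun w => (p w).2.1) _ w₀ := hpd.snd.fst
  have hx : HasFDerivAt (fun w => (p w).2.2.1) _ w₀ := hpd.snd.snd.fst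
  have hy : HasFDerivAt (fun w => (p w).2.2.2) _ w₀ := hpd.snd.snd.snd
  have hT : HasFDerivAt (fun w => timeCoord (p w).2.1) _ w₀ :=
    (contDiff_timeCoord.differentiable (by simp) _).hasDerivAt.comp_hasFDerivAt w₀ ht
  have hY : DifferentiableAt ℝ (fun w => angleCoord F (p w).2) w₀ :=
    DifferentiableAt.comp (g := angleCoord F) w₀
      ((contDiff_angleCoord F).differentiable (by simp) _) hpd.snd.differentiableAt
  have hGx : HasFDerivAt (fun w => G (p w).2.2.1) _ w₀ :=
    (hG.differentiable (by simp) _).hasDerivAt.comp_hasFDerivAt w₀ hx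
  have hKx : HasFDerivAt (fun w => K (p w).2.2.1) _ w₀ :=
    (hK.differentiable (by simp) _).hasDerivAt.comp_hasFDerivAt w₀ hx
  have e1 : chartJac z (fun p => fstFun h hab hGc (u p).2) (fun p => angleFun F (u p).2) w₀ =
      jac (fun w => G (p w).2.2.1)
        (fun w => Complex.exp (2 * Real.pi * angleCoord F (p w).2 * Complex.I)) w₀ :=
    jac_congr (hf.comp_eventuallyEq (h := fun c => G c.2.1) fun c => rfl)
      (hf.comp_eventuallyEq
        (h := fun c => Complex.exp (2 * Real.pi * angleCoord F c * Complex.I)) fun c => rfl)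
  have e2 : chartJac z (fun p => fstFun h hab hKc (u p).2) (fun p => timeFun F (u p).2) w₀ =
      jac (fun w => K (p w).2.2.1)
        (fun w => Complex.exp (2 * Real.pi * timeCoord (p w).2.1 * Complex.I)) w₀ :=
    jac_congr (hf.comp_eventuallyEq (h := fun c => K c.2.1) fun c => rfl)
      (hf.comp_eventuallyEq
        (h := fun c => Complex.exp (2 * Real.pi * timeCoord c.1 * Complex.I)) fun c => rfl)
  rw [e1, e2, jac_exp hY, jac_exp hT.differentiableAt, hGx.fderiv, hKx.fderiv]
  by_cases hstrip : (p w₀).2.2.1 ∈ Ioo a b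
  · have hev : (fun w => angleCoord F (p w).2) =ᶠ[𝓝 w₀]
        fun w => (p w).2.2.2 - timeCoord (p w).2.1 * (p w).2.2.1 := by
      filter_upwards [hx.continuousAt (isOpen_Ioo.mem_nhds hstrip)] with w hw
      exact angleCoord_eq h _ hw.1.le hw.2.le
    have hYd : HasFDerivAt (fun w => (p w).2.2.2 - timeCoord (p w).2.1 * (p w).2.2.1) _ w₀ :=
      hy.sub (hT.mul hx)
    rw [hev.fderiv_eq, hYd.fderiv, hT.fderiv, hKd]
    have hJ := hf.2.self_of_nhds.2 1
    rw [mul_one] at hJ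
    have harea := J.area_nonneg (a := ((f w₀).2.1, ((f w₀).2.2 : ℝ × ℝ))) (f w₀).2.2.2 (D 1)
    have hDI : D Complex.I = J.J ((f w₀).2.1, ((f w₀).2.2 : ℝ × ℝ)) (D 1) := hJ
    rw [← hDI] at harea
    have := mul_nonneg (hGn (p w₀).2.2.1) harea
    simp
    nlinarith
  · rw [hKd, hG0 _ hstrip]
    simp

/-! ### Behaviour near the punctures -/

theorem endCoord_one (ζ : S) (σ : ℝ) : endCoord ζ (σ, 1) = endCoord ζ (σ, 0) := by
  unfold endCoord
  congr 2
  rw [← Complex.exp_periodic]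
  congr 1
  push_cast
  ring

/-- Cylindrical coordinates with `τ` in one period fill a punctured neighbourhood, so uniform limits
along an end become statements near the puncture. Here `τ` is `-arg / 2π`, shifted by `1` if the
argument is positive. -/
theorem eventually_endCoord (ζ : S) (σ₁ : ℝ) : ∀ᶠ p in 𝓝[≠] ζ,
    ∃ σ > σ₁, ∃ τ ∈ Icc (0 : ℝ) 1, endCoord ζ (σ, τ) = p := by
  set e := chartAt ℂ ζ with he
  have hζ : ζ ∈ e.source := mem_chart_source ℂ ζ
  have hpi := Real.pi_pos
  have h1 : ∀ᶠ p in 𝓝 ζ, e p ∈ Metric.ball (e ζ) (Real.exp (-(2 * Real.pi * σ₁))) :=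
    (e.continuousAt hζ) (Metric.ball_mem_nhds _ (Real.exp_pos _))
  filter_upwards [nhdsWithin_le_nhds h1, nhdsWithin_le_nhds (e.open_source.mem_nhds hζ),
    self_mem_nhdsWithin] with p hp hps hne
  set v := e p - e ζ with hv
  have hv0 : v ≠ 0 := fun h0 => hne (e.injOn hps hζ (sub_eq_zero.1 h0))
  have hvn : ‖v‖ < Real.exp (-(2 * Real.pi * σ₁)) := by
    rw [hv, ← dist_eq_norm]; exact hp
  have hvpos : 0 < ‖v‖ := norm_pos_iff.2 hv0
  have key : ∀ τ : ℝ, (∃ n : ℤ, τ = -(v.arg / (2 * Real.pi)) + n) →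
      endCoord ζ (-(Real.log ‖v‖ / (2 * Real.pi)), τ) = p := by
    rintro τ ⟨n, rfl⟩
    have h2 : Complex.exp (-(2 * Real.pi * (((-(Real.log ‖v‖ / (2 * Real.pi)) : ℝ) : ℂ) +
        ((-(v.arg / (2 * Real.pi)) + n : ℝ) : ℂ) * Complex.I))) = v := by
      rw [← Complex.exp_log hv0]
      refine Complex.exp_eq_exp_iff_exists_int.2 ⟨-n, ?_⟩
      rw [Complex.log, Complex.exp_add, ← Complex.ofReal_exp, Real.exp_log hvpos,
        Complex.norm_mul_exp_arg_mul_I]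
      have hpi' : (Real.pi : ℂ) ≠ 0 := by exact_mod_cast hpi.ne'
      push_cast
      field_simp
      ring
    unfold endCoord
    rw [h2, hv, ← he, add_sub_cancel, e.left_inv hps]
  refine ⟨-(Real.log ‖v‖ / (2 * Real.pi)), ?_, ?_⟩
  · have h3 : Real.log ‖v‖ < -(2 * Real.pi * σ₁) := (Real.log_lt_iff_lt_exp hvpos).2 hvn
    have h4 : Real.log ‖v‖ / (2 * Real.pi) < -σ₁ := by
      rw [div_lt_iff₀ (by positivity)]; linarith
    show σ₁ < _
    linarith
  · have ha1 := Complex.neg_pi_lt_arg v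
    have ha2 := Complex.arg_le_pi v
    have hb : v.arg / (2 * Real.pi) ≤ 1 / 2 := by rw [div_le_iff₀ (by positivity)]; linarith
    have hb2 : -(1 / 2) ≤ v.arg / (2 * Real.pi) := by rw [le_div_iff₀ (by positivity)]; linarith
    rcases le_or_gt v.arg 0 with hneg | hpos
    · have : v.arg / (2 * Real.pi) ≤ 0 := div_nonpos_of_nonpos_of_nonneg hneg (by positivity)
      exact ⟨-(v.arg / (2 * Real.pi)), ⟨by linarith, by linarith⟩, key _ ⟨0, by simp⟩⟩
    · have : 0 ≤ v.arg / (2 * Real.pi) := by positivity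
      exact ⟨-(v.arg / (2 * Real.pi)) + 1, ⟨by linarith, by linarith⟩, key _ ⟨1, by simp⟩⟩

theorem IsEnd.hasWinding_time {F : PerturbedTwist Q X₁ X₂ ε} {u : S → ℝ × MappingTorus F} {ζ : S}
    {l : Filter ℝ} {N : ℤ} {z : ℝ × ℝ} (h : IsEnd F u ζ l N z) :
    HasWinding (fun p => timeFun F (u p).2) ζ N := by
  obtain ⟨-, σ₀, g, hgc, hg, hgN, -⟩ := h
  refine ⟨σ₀, fun c => timeCoord (g c).1,
    contDiff_timeCoord.continuous.comp_continuousOn (continuous_fst.comp_continuousOn hgc),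
    fun c hc => by simp only [← hg c hc]; rfl, fun σ hσ => ?_⟩
  have h1 := hgN σ 0 hσ
  rw [zero_add] at h1
  have h2 := timeCoord_sub_int ((g (σ, 0)).1 + N) N
  rw [add_sub_cancel_right] at h2
  simp only [h1, h2]
  ring

/-- The lift along an end closes up to a deck transformation. Its time shift is `-N`, and its
integer translation in `y` is pinned down by the limit point `z`, since both endpoints of the lift
are close to `z`. -/
theorem IsEnd.hasWinding_angle {F : PerturbedTwist Q X₁ X₂ ε} {u : S → ℝ × MappingTorus F} {ζ : S}
    {l : Filter ℝ} {N κ : ℤ} {z : ℝ × ℝ} (h : IsEnd F u ζ l N z)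
    (hz : (F.φ ^ (-N)) z + (0, (κ : ℝ)) = z) :
    HasWinding (fun p => angleFun F (u p).2) ζ κ := by
  obtain ⟨-, σ₀, g, hgc, hg, hgN, hlim⟩ := h
  obtain ⟨δ, hδ, hcont⟩ := Metric.continuousAt_iff.1
    ((contDiff_zpow F (-N)).continuous.continuousAt (x := z)) (1 / 2) (by norm_num)
  obtain ⟨σ₁, hσ₁⟩ := hlim (min δ (1 / 2)) (lt_min hδ (by norm_num))
  refine ⟨max σ₀ σ₁, fun c => angleCoord F ((g c).1, ((g c).2 : ℝ × ℝ)), ?_,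
    fun c hc => by simp only [← hg c ((le_max_left _ _).trans_lt hc)]; rfl, fun σ hσ => ?_⟩
  · refine (contDiff_angleCoord F).continuous.comp_continuousOn
      (ContinuousOn.mono ?_ fun c hc => (le_max_left σ₀ σ₁).trans_lt hc)
    exact (continuous_fst.prodMk
      (continuous_subtype_val.comp continuous_snd)).comp_continuousOn hgc
  · have hs0 : σ₀ < σ := (le_max_left _ _).trans_lt hσ
    have hs1 : σ₁ < σ := (le_max_right _ _).trans_lt hσ
    have h1 := hgN σ 0 hs0
    rw [zero_add] at h1
    have h2 : proj F (g (σ, 0)) = proj F (g (σ, 1)) := by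
      rw [hg _ hs0, hg _ hs0, endCoord_one]
    obtain ⟨n, k, hn, hk⟩ := Quotient.exact h2
    have hnN : n = -N := by
      have : (n : ℝ) = -N := by linarith
      exact_mod_cast this
    have hA := hσ₁ σ hs1 0 ⟨le_rfl, zero_le_one⟩
    have hB := hσ₁ σ hs1 1 ⟨zero_le_one, le_rfl⟩
    have hA' := hcont (hA.trans_le (min_le_left _ _))
    have hB' := hB.trans_le (min_le_right _ _)
    rw [hk, hnN] at hB'
    -- Each of the two approximations costs less than `1/2`, so the integers differ by less than
    -- `1`.
    have hkκ : k = κ := by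
      have h3 : |(k : ℝ) - κ| < 1 := by
        have h4 := abs_lt.1 ((le_max_right _ _).trans_lt hA')
        have h5 := abs_lt.1 ((le_max_right _ _).trans_lt hB')
        have h6 := congrArg Prod.snd hz
        simp only [Prod.snd_add] at h4 h5 h6
        rw [abs_lt]
        constructor <;> linarith [h4.1, h4.2, h5.1, h5.2]
      have h7 : |k - κ| < 1 := by exact_mod_cast h3
      exact sub_eq_zero.1 (Int.abs_lt_one_iff.1 h7)
    simp only [hn, hk, angleCoord_deck, hkκ]
    ring

theorem IsEnd.eventually_fstFun {F : PerturbedTwist Q X₁ X₂ ε} {u : S → ℝ × MappingTorus F} {ζ : S}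
    {l : Filter ℝ} {N : ℤ} {z : ℝ × ℝ} (h : IsEnd F u ζ l N z) {a b : ℝ} (ht : IsTwistOn F a b)
    (hab : a ≤ b) {g : ℝ → ℝ} (hg : IsConstOff g a b) (hz : z.1 < a ∨ b < z.1) :
    ∀ᶠ p in 𝓝[≠] ζ, fstFun ht hab hg (u p).2 = g z.1 := by
  obtain ⟨-, σ₀, f, -, hf, -, hlim⟩ := h
  have key : ∃ δ > 0, ∀ x : ℝ × ℝ, dist x z < δ → g x.1 = g z.1 := by
    rcases hz with hz | hz
    · refine ⟨a - z.1, sub_pos.2 hz, fun x hx => hg.1 _ _ ?_ hz.le⟩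
      have h4 := abs_lt.1 ((le_max_left _ _).trans_lt hx)
      linarith [h4.2]
    · refine ⟨z.1 - b, sub_pos.2 hz, fun x hx => hg.2 _ _ ?_ hz.le⟩
      have h4 := abs_lt.1 ((le_max_left _ _).trans_lt hx)
      linarith [h4.1]
  obtain ⟨δ, hδ, hgδ⟩ := key
  obtain ⟨σ₁, hσ₁⟩ := hlim δ hδ
  filter_upwards [eventually_endCoord ζ (max σ₀ σ₁)] with p hp
  obtain ⟨σ, hσ, τ, hτ, rfl⟩ := hp
  rw [← hf _ ((le_max_left _ _).trans_lt hσ)]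
  exact hgδ _ (hσ₁ σ ((le_max_right _ _).trans_lt hσ) τ hτ)

/-! ### The flux inequality -/

/-- The flux of a flow line through a strip over which the map is the twist is nonnegative. -/
theorem FlowLine.exists_flux_le [T2Space S] [CompactSpace S] [IsManifold 𝓘(ℂ, ℂ) ω S]
    {F : PerturbedTwist Q X₁ X₂ ε} {J : AdmissibleJ F} {α β : Multiset OrbitLabel}
    (C : FlowLine F J α β S) {a b : ℝ} (hab : a < b) (ht : IsTwistOn F a b)
    (hpt : ∀ γ, γ ∈ α ∨ γ ∈ β → (F.pt γ).1 < a ∨ b < (F.pt γ).1)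
    (hper : ∀ γ, γ ∈ α ∨ γ ∈ β → F.φ^[γ.2.den] (F.pt γ) = F.pt γ - (0, (γ.2.num : ℝ))) :
    ∃ c ∈ Icc a b,
      (β.map fun γ => if (F.pt γ).1 < a then (γ.2.num : ℝ) - c * γ.2.den else 0).sum ≤
      (α.map fun γ => if (F.pt γ).1 < a then (γ.2.num : ℝ) - c * γ.2.den else 0).sum := by
  classical
  have : IsManifold 𝓘(ℝ, ℂ) ∞ S := isManifold_real
  obtain ⟨p⟩ := nonempty_chartPartition (S := S)
  obtain ⟨G, K, c, hc, hG, hK, hGn, hKd, hG0, hGa, hGb⟩ := exists_step hab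
  refine ⟨c, hc, ?_⟩
  set w : OrbitLabel → ℝ := fun γ => if (F.pt γ).1 < a then (γ.2.num : ℝ) - c * γ.2.den else 0
    with hw
  have hGc : IsConstOff G a b := ⟨fun x y hx hy => by rw [(hGa x hx).1, (hGa y hy).1],
    fun x y hx hy => by rw [(hGb x hx).1, (hGb y hy).1]⟩
  have hKc : IsConstOff K a b := ⟨fun x y hx hy => by rw [(hGa x hx).2, (hGa y hy).2],
    fun x y hx hy => by rw [(hGb x hx).2, (hGb y hy).2]⟩
  set P : Finset S := C.out ∪ C.inc with hP
  have hmemo : ∀ ζ ∈ C.out, C.orbit ζ ∈ α := fun ζ hζ =>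
    mem_of_end (fun ζ hζ => C.mult_pos ζ (.inl hζ)) C.out_total hζ
  have hmemi : ∀ ζ ∈ C.inc, C.orbit ζ ∈ β := fun ζ hζ =>
    mem_of_end (fun ζ hζ => C.mult_pos ζ (.inr hζ)) C.inc_total hζ
  have hmem : ∀ ζ ∈ P, C.orbit ζ ∈ α ∨ C.orbit ζ ∈ β := fun ζ hζ =>
    (Finset.mem_union.1 hζ).imp (hmemo ζ) (hmemi ζ)
  -- The sign of an end; it makes the two kinds of puncture instances of one formula.
  set s : S → ℤ := fun ζ => if ζ ∈ C.out then 1 else -1 with hs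
  have hend : ∀ ζ ∈ P, ∃ l, IsEnd F C.u ζ l (s ζ * (C.mult ζ * (C.orbit ζ).2.den))
      (F.pt (C.orbit ζ)) := by
    intro ζ hζ
    by_cases ho : ζ ∈ C.out
    · refine ⟨atTop, ?_⟩
      simp only [hs, if_pos ho, one_mul]
      exact C.out_end ζ ho
    · have hi : ζ ∈ C.inc := (Finset.mem_union.1 hζ).resolve_left ho
      refine ⟨atBot, ?_⟩
      simp only [hs, if_neg ho, neg_one_mul]
      exact C.inc_end ζ hi
  set kT : S → ℝ := fun ζ => ((s ζ * (C.mult ζ * (C.orbit ζ).2.den) : ℤ) : ℝ) with hkT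
  -- The minus sign reflects that the orbit labelled `p/q` turns `-p` times around the cylinder.
  set kY : S → ℝ := fun ζ => ((-(s ζ * (C.mult ζ * (C.orbit ζ).2.num)) : ℤ) : ℝ) with hkY
  have hwT : ∀ ζ ∈ P, HasWinding (fun p => timeFun F (C.u p).2) ζ (kT ζ) := by
    intro ζ hζ
    obtain ⟨l, hl⟩ := hend ζ hζ
    exact hl.hasWinding_time
  have hwY : ∀ ζ ∈ P, HasWinding (fun p => angleFun F (C.u p).2) ζ (kY ζ) := by
    intro ζ hζ
    obtain ⟨l, hl⟩ := hend ζ hζ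
    refine hl.hasWinding_angle ?_
    have hq := hper _ (hmem ζ hζ)
    by_cases ho : ζ ∈ C.out
    · simp only [hs, if_pos ho, one_mul]
      rw [zpow_neg_iterate_apply F hq]
      ext
      · simp
      · push_cast; simp
    · simp only [hs, if_neg ho, neg_one_mul, neg_neg]
      rw [zpow_iterate_apply F hq]
      ext <;> simp
  -- The value of `u` at a puncture is arbitrary. Replacing the function there by its asymptotic
  -- value makes it constant near each puncture, because the asymptotic orbits lie off the strip.
  have modified : ∀ {g : ℝ → ℝ} (_ : ContDiff ℝ ∞ g) (hgc : IsConstOff g a b)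
      {h : ℝ × (ℝ × ℝ) → ℝ} {E : MappingTorus F → ℂ} (_ : ContDiff ℝ ∞ h)
      (_ : ∀ c : Cov X₁ X₂, E (proj F c) =
        Complex.exp (2 * Real.pi * h (c.1, (c.2 : ℝ × ℝ)) * Complex.I))
      (_ : ∀ q, ‖E q‖ = 1),
      ∃ f : S → ℝ, (∀ z ∉ P, f =ᶠ[𝓝 z] fun p => fstFun ht hab.le hgc (C.u p).2) ∧
        (∀ z ∉ P, SmoothPair f (fun p => E (C.u p).2) z) ∧
        ∀ ζ ∈ P, f =ᶠ[𝓝 ζ] fun _ => g (F.pt (C.orbit ζ)).1 := by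
    intro g hg hgc h E hh hE hEn
    set f : S → ℝ := fun z => if z ∈ P then g (F.pt (C.orbit z)).1
      else fstFun ht hab.le hgc (C.u z).2 with hf
    have hoff : ∀ z ∉ P, f =ᶠ[𝓝 z] fun p => fstFun ht hab.le hgc (C.u p).2 := by
      intro z hz
      filter_upwards [P.finite_toSet.isClosed.isOpen_compl.mem_nhds
        (show z ∈ (P : Set S)ᶜ from hz)] with x hx
      exact if_neg hx
    refine ⟨f, hoff, fun z hz => ?_, fun ζ hζ => ?_⟩
    · have hzo : z ∉ C.out := fun h => hz (Finset.mem_union_left _ h)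
      have hzi : z ∉ C.inc := fun h => hz (Finset.mem_union_right _ h)
      have hu := C.holo z hzo hzi
      refine ⟨ContMDiffAt.congr_of_eventuallyEq ?_ (hoff z hz), ?_,
        Eventually.of_forall fun y => hEn _⟩
      · exact hu.contMDiffAt_comp (h := fun c => g c.2.1) (fun c => rfl)
          (hg.comp (contDiff_fst.comp contDiff_snd))
      · exact hu.contMDiffAt_comp hE (contDiff_exp_two_pi hh)
    · obtain ⟨l, hl⟩ := hend ζ hζ
      have h1 := hl.eventually_fstFun ht hab.le hgc (hpt _ (hmem ζ hζ))
      have h2 : ∀ᶠ x in 𝓝 ζ, x ∉ P.erase ζ :=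
        (P.erase ζ).finite_toSet.isClosed.isOpen_compl.mem_nhds (by simp)
      rw [eventually_nhdsWithin_iff] at h1
      filter_upwards [h1, h2] with x hx1 hx2
      by_cases hxζ : x = ζ
      · subst hxζ
        exact if_pos hζ
      · have hxP : x ∉ P := fun h => hx2 (Finset.mem_erase.2 ⟨hxζ, h⟩)
        exact (if_neg hxP).trans (hx1 hxζ)
  obtain ⟨fG, hfG1, hfG2, hfG3⟩ := modified hG hGc (contDiff_angleCoord F)
    (E := angleFun F) (fun c => rfl) (norm_angleFun F)
  obtain ⟨fK, hfK1, hfK2, hfK3⟩ := modified hK hKc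
    (h := fun c => timeCoord c.1) (contDiff_timeCoord.comp contDiff_fst)
    (E := timeFun F) (fun c => rfl) (norm_timeFun F)
  have hAG : Adapted fG fun p => angleFun F (C.u p).2 := fun z => by
    by_cases hz : z ∈ P
    · exact .inl ((hfG3 z hz).trans (by rw [(hfG3 z hz).self_of_nhds]))
    · exact .inr (hfG2 z hz)
  have hAK : Adapted fK fun p => timeFun F (C.u p).2 := fun z => by
    by_cases hz : z ∈ P
    · exact .inl ((hfK3 z hz).trans (by rw [(hfK3 z hz).self_of_nhds]))
    · exact .inr (hfK2 z hz)
  have hpos : 0 ≤ flux p fG (fun p => angleFun F (C.u p).2) +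
      flux p fK (fun p => timeFun F (C.u p).2) := by
    unfold flux
    rw [← Finset.sum_add_distrib]
    refine Finset.sum_nonneg fun i _ => ?_
    rw [← MeasureTheory.integral_add
      (integrableOn_mul_chartJac hAG (p.smooth i).continuous (.inl (p.tsupport_subset i)))
      (integrableOn_mul_chartJac hAK (p.smooth i).continuous (.inl (p.tsupport_subset i)))]
    refine MeasureTheory.setIntegral_nonneg (chartAt ℂ i).open_target.measurableSet fun x hx => ?_
    rw [← mul_add]
    refine mul_nonneg (p.nonneg _ _) ?_
    set z := (chartAt ℂ i).symm x with hz
    have hzs : z ∈ (chartAt ℂ z).source := mem_chart_source ℂ z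
    -- The density is moved to the chart centred at the point itself, the only place where the
    -- Cauchy-Riemann equation is used.
    rw [hAG.chartJac_transition hx hzs, hAK.chartJac_transition hx hzs, ← mul_add]
    refine mul_nonneg (by positivity) ?_
    have hzt : chartAt ℂ z z ∈ (chartAt ℂ z).target := (chartAt ℂ z).map_source hzs
    have hzl := (chartAt ℂ z).left_inv hzs
    by_cases hzP : z ∈ P
    · rw [chartJac_eq_zero hzt (by rw [hzl]; exact hfG3 z hzP),
        chartJac_eq_zero hzt (by rw [hzl]; exact hfK3 z hzP), add_zero]
    · have hu := C.holo z (fun h => hzP (Finset.mem_union_left _ h))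
        (fun h => hzP (Finset.mem_union_right _ h))
      have := density_nonneg ht hab.le hG hK hGn hKd hG0 hGc hKc hu
      have hten := tendsto_chart_symm hzt
      rw [hzl] at hten
      have e1 : chartJac z fG (fun p => angleFun F (C.u p).2) (chartAt ℂ z z) = _ :=
        jac_congr (hten.eventually (hfG1 z hzP)) EventuallyEq.rfl
      have e2 : chartJac z fK (fun p => timeFun F (C.u p).2) (chartAt ℂ z z) = _ :=
        jac_congr (hten.eventually (hfK1 z hzP)) EventuallyEq.rfl
      rw [e1, e2]
      exact this
  rw [flux_eq_sum p P hfG2 hfG3 hwY, flux_eq_sum p P hfK2 hfK3 hwT,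
    ← Finset.sum_add_distrib] at hpos
  -- Left of the strip `G = -1` and `K = -c`, which gives `p - cq` per multiplicity; right of it
  -- both vanish.
  have hterm : ∀ ζ ∈ P, G (F.pt (C.orbit ζ)).1 * kY ζ + K (F.pt (C.orbit ζ)).1 * kT ζ =
      s ζ * (C.mult ζ * w (C.orbit ζ)) := by
    intro ζ hζ
    simp only [hkY, hkT, hw]
    push_cast
    rcases hpt _ (hmem ζ hζ) with h | h
    · rw [if_pos h, (hGa _ h.le).1, (hGa _ h.le).2]
      ring
    · rw [if_neg (by linarith), (hGb _ h.le).1, (hGb _ h.le).2]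
      ring
  rw [Finset.sum_congr rfl hterm, hP, Finset.sum_union C.disj] at hpos
  have ho : ∑ ζ ∈ C.out, (s ζ : ℝ) * (C.mult ζ * w (C.orbit ζ)) = (α.map w).sum := by
    rw [← sum_ends_eq (fun ζ hζ => C.mult_pos ζ (.inl hζ)) C.out_total w]
    exact Finset.sum_congr rfl fun ζ hζ => by simp [hs, hζ]
  have hi : ∑ ζ ∈ C.inc, (s ζ : ℝ) * (C.mult ζ * w (C.orbit ζ)) = -(β.map w).sum := by
    rw [← sum_ends_eq (fun ζ hζ => C.mult_pos ζ (.inr hζ)) C.inc_total w, ← Finset.sum_neg_distrib]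
    refine Finset.sum_congr rfl fun ζ hζ => ?_
    have : ζ ∉ C.out := Finset.disjoint_right.1 C.disj hζ
    simp [hs, this]
  rw [ho, hi] at hpos
  linarith

end Curves

end CylTwist

/-! ### Polygonal paths and their support functions. -/

namespace CylTwist

variable {Q : ℕ} {X₁ X₂ ε : ℝ}

theorem num_sub_mul_den (r : ℝ) (s : ℚ) : (s.num : ℝ) - r * s.den = s.den * ((s : ℝ) - r) := by
  have h : (s.num : ℝ) = s * s.den := by exact_mod_cast (Rat.mul_den_eq_num s).symm
  rw [h]; ring

/-- The value at slope `r` of the support function of the region bounded by `𝒫(α)`. -/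
noncomputable def supportVal (α : Multiset OrbitLabel) (r : ℝ) : ℝ :=
  (α.map fun γ => max 0 ((γ.2.num : ℝ) - r * γ.2.den)).sum

theorem sum_slopes (α : Multiset OrbitLabel) (f : ℚ → ℝ) :
    ((slopes α).map f).sum = (α.map fun γ => f γ.2).sum := by
  rw [← Multiset.sum_coe, ← Multiset.map_coe, slopes, Multiset.sort_eq, Multiset.map_map]
  rfl

/-- The functional `(p,q) ↦ p - rq` at a vertex. -/
theorem vertex_apply (α : Multiset OrbitLabel) (j : ℕ) (r : ℝ) :
    (vertex α j).1 - r * (vertex α j).2 =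
      (((slopes α).take j).map fun s => (s.num : ℝ) - r * s.den).sum := by
  unfold vertex
  induction (slopes α).take j with
  | nil => simp
  | cons s L ih =>
    simp only [List.map_cons, List.sum_cons, Prod.fst_add, Prod.snd_add]
    linarith

theorem supportVal_eq (α : Multiset OrbitLabel) (j : ℕ) (r : ℝ) :
    supportVal α r = (((slopes α).take j).map fun s => max 0 ((s.num : ℝ) - r * s.den)).sum +
      (((slopes α).drop j).map fun s => max 0 ((s.num : ℝ) - r * s.den)).sum := by
  rw [supportVal, ← sum_slopes α fun s => max 0 ((s.num : ℝ) - r * s.den), ← List.sum_append,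
    ← List.map_append, List.take_append_drop]

/-- A partial sum of the numbers `p - rq` is at most the sum of all their positive parts. -/
theorem vertex_apply_le (α : Multiset OrbitLabel) (j : ℕ) (r : ℝ) :
    (vertex α j).1 - r * (vertex α j).2 ≤ supportVal α r := by
  rw [vertex_apply, supportVal_eq α j r]
  have h1 : (((slopes α).take j).map fun s => (s.num : ℝ) - r * s.den).sum ≤
      (((slopes α).take j).map fun s => max 0 ((s.num : ℝ) - r * s.den)).sum :=
    List.sum_le_sum fun s _ => le_max_right _ _
  have h2 : 0 ≤ (((slopes α).drop j).map fun s => max 0 ((s.num : ℝ) - r * s.den)).sum :=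
    List.sum_nonneg fun x hx => by
      obtain ⟨s, -, rfl⟩ := List.mem_map.1 hx
      exact le_max_left _ _
  linarith

theorem polyPath_apply_le {α : Multiset OrbitLabel} {w : ℝ × ℝ} (hw : w ∈ polyPath α) (r : ℝ) :
    w.1 - r * w.2 ≤ supportVal α r := by
  obtain ⟨j, -, c, d, hc, hd, hcd, rfl⟩ := hw
  have h1 := vertex_apply_le α j r
  have h2 := vertex_apply_le α (j + 1) r
  simp only [Prod.fst_add, Prod.snd_add, Prod.smul_fst, Prod.smul_snd, smul_eq_mul]
  calc _ = c * ((vertex α j).1 - r * (vertex α j).2) +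
        d * ((vertex α (j + 1)).1 - r * (vertex α (j + 1)).2) := by ring
    _ ≤ c * supportVal α r + d * supportVal α r := by gcongr
    _ = supportVal α r := by rw [← add_mul, hcd, one_mul]

/-- Let `r` be the ratio `p/q` of the edge containing `w`. Since the factors are sorted, the terms
`p - rq` are nonnegative before this edge, zero on it and nonpositive after it, so the functional is
constant on the edge and equals the sum of positive parts. -/
theorem exists_supportVal_eq {β : Multiset OrbitLabel} {w : ℝ × ℝ} (hw : w ∈ polyPath β) :
    ∃ γ ∈ β, w.1 - (γ.2 : ℝ) * w.2 = supportVal β γ.2 := by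
  obtain ⟨j, hj, c, d, hc, hd, hcd, rfl⟩ := hw
  have hsorted : (slopes β).Pairwise (· ≥ ·) := Multiset.pairwise_sort _ _
  have hmem : (slopes β)[j] ∈ slopes β := List.getElem_mem hj
  set r := (slopes β)[j] with hr
  have hmem' : r ∈ β.map Prod.snd := by
    rwa [slopes, Multiset.mem_sort] at hmem
  obtain ⟨γ, hγ, hγr⟩ := Multiset.mem_map.1 hmem'
  refine ⟨γ, hγ, ?_⟩
  rw [hγr]
  have htake : ∀ s ∈ (slopes β).take j, r ≤ s := by
    intro s hs
    obtain ⟨i, hi, rfl⟩ := List.mem_take_iff_getElem.1 hs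
    exact List.pairwise_iff_getElem.1 hsorted _ _ _ hj (lt_min_iff.1 hi).1
  have hdrop : ∀ s ∈ (slopes β).drop j, s ≤ r := by
    intro s hs
    obtain ⟨i, hi, rfl⟩ := List.mem_drop_iff_getElem.1 hs
    rcases Nat.eq_zero_or_pos i with rfl | hi0
    · simp [hr]
    · exact List.pairwise_iff_getElem.1 hsorted j (j + i) hj (by omega) (by omega)
  have h1 : (vertex β j).1 - r * (vertex β j).2 = supportVal β r := by
    rw [vertex_apply, supportVal_eq β j]
    have e1 : ((slopes β).take j).map (fun s => max 0 ((s.num : ℝ) - r * s.den)) =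
        ((slopes β).take j).map (fun s => (s.num : ℝ) - r * s.den) := by
      refine List.map_congr_left fun s hs => max_eq_right ?_
      rw [num_sub_mul_den]
      have : (r : ℝ) ≤ s := by exact_mod_cast htake s hs
      exact mul_nonneg (by positivity) (by linarith)
    have e2 : (((slopes β).drop j).map fun s => max 0 ((s.num : ℝ) - r * s.den)).sum = 0 := by
      refine List.sum_eq_zero fun x hx => ?_
      obtain ⟨s, hs, rfl⟩ := List.mem_map.1 hx
      refine max_eq_left ?_
      rw [num_sub_mul_den]
      have : (s : ℝ) ≤ r := by exact_mod_cast hdrop s hs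
      exact mul_nonpos_of_nonneg_of_nonpos (by positivity) (by linarith)
    rw [e1, e2, add_zero]
  have h2 : (vertex β (j + 1)).1 - r * (vertex β (j + 1)).2 = supportVal β r := by
    rw [← h1, vertex_apply, vertex_apply, List.take_add_one, List.getElem?_eq_getElem hj]
    simp [← hr, num_sub_mul_den]
  simp only [Prod.fst_add, Prod.snd_add, Prod.smul_fst, Prod.smul_snd, smul_eq_mul]
  calc _ = c * ((vertex β j).1 - r * (vertex β j).2) +
        d * ((vertex β (j + 1)).1 - r * (vertex β (j + 1)).2) := by ring
    _ = supportVal β r := by rw [h1, h2, ← add_mul, hcd, one_mul]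

/-- The edge of `𝒫(β)` through the left point supports `𝒫(β)`, and the right point at the same
height lies strictly beyond its line. -/
theorem CrossesRight.exists_supportVal_lt {α β : Multiset OrbitLabel} (h : CrossesRight α β) :
    ∃ γ ∈ β, supportVal β γ.2 < supportVal α γ.2 := by
  obtain ⟨a, ha, b, hb, hab, hlt⟩ := h
  obtain ⟨γ, hγ, hγb⟩ := exists_supportVal_eq hb
  refine ⟨γ, hγ, ?_⟩
  have := polyPath_apply_le ha γ.2
  rw [hab] at this
  linarith

/-- Clearing the denominator of `r` turns a strict inequality between support values into a definite
gap, independent of `ε`. -/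
theorem exists_int_supportVal (α : Multiset OrbitLabel) (r : ℚ) :
    ∃ n : ℤ, supportVal α r * r.den = n := by
  refine ⟨(α.map fun γ => max 0 (γ.2.num * r.den - r.num * γ.2.den)).sum, ?_⟩
  rw [supportVal, ← Multiset.sum_map_mul_right, Int.cast_multiset_sum, Multiset.map_map]
  congr 1
  refine Multiset.map_congr rfl fun γ _ => ?_
  have h : (r.num : ℝ) = r * r.den := by exact_mod_cast (Rat.mul_den_eq_num r).symm
  simp only [Function.comp_apply]
  push_cast
  rw [h, max_mul_of_nonneg _ _ (by positivity), zero_mul]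
  congr 1
  ring

theorem CrossesRight.exists_supportVal_gap {α β : Multiset OrbitLabel} (h : CrossesRight α β) :
    ∃ γ ∈ β, 1 ≤ (supportVal α γ.2 - supportVal β γ.2) * γ.2.den := by
  obtain ⟨γ, hγ, hlt⟩ := h.exists_supportVal_lt
  refine ⟨γ, hγ, ?_⟩
  obtain ⟨m, hm⟩ := exists_int_supportVal α γ.2
  obtain ⟨n, hn⟩ := exists_int_supportVal β γ.2
  have hd : (0 : ℝ) < γ.2.den := by exact_mod_cast γ.2.den_pos
  have h1 : (n : ℝ) < m := by
    rw [← hm, ← hn]; gcongr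
  have h2 : n + 1 ≤ m := by exact_mod_cast h1
  have h3 : (n : ℝ) + 1 ≤ m := by exact_mod_cast h2
  rw [sub_mul, hm, hn]
  linarith

theorem IsGenerator.den_le {P : ℤ} {α : Multiset OrbitLabel} (h : IsGenerator X₁ X₂ P Q α)
    {γ : OrbitLabel} (hγ : γ ∈ α) : γ.2.den ≤ Q := by
  rw [← h.sum_den]
  exact Multiset.le_sum_of_mem (Multiset.mem_map_of_mem (fun γ => γ.2.den) hγ)

theorem IsGenerator.cast_sum_den {P : ℤ} {α : Multiset OrbitLabel}
    (h : IsGenerator X₁ X₂ P Q α) : (α.map fun γ => (γ.2.den : ℝ)).sum = Q := by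
  rw [← h.sum_den, Nat.cast_multiset_sum, Multiset.map_map]
  rfl

theorem IsGenerator.sum_num_sub {P : ℤ} {α : Multiset OrbitLabel} (h : IsGenerator X₁ X₂ P Q α)
    (r : ℝ) : (α.map fun γ => (γ.2.num : ℝ) - r * γ.2.den).sum = P - r * Q := by
  have h1 : (α.map fun γ => (γ.2.num : ℝ)).sum = P := by
    rw [← h.sum_num, Int.cast_multiset_sum, Multiset.map_map]
    rfl
  rw [Multiset.sum_map_sub, Multiset.sum_map_mul_left, h1, h.cast_sum_den]

/-! ### Choice of the strip and comparison of weights. -/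

/-- Distinct rational numbers of denominator at most `Q` are `1/Q²` apart. -/
theorem gap_of_den_le {r s : ℚ} (hr : r.den ≤ Q) (hs : s.den ≤ Q) (h : r < s) :
    1 ≤ ((s : ℝ) - r) * (Q : ℝ) ^ 2 := by
  have hrd : (0 : ℝ) < r.den := by exact_mod_cast r.den_pos
  have hsd : (0 : ℝ) < s.den := by exact_mod_cast s.den_pos
  have h0 : (0 : ℝ) < s - r := by
    have : (r : ℝ) < s := by exact_mod_cast h
    linarith
  have h1 : (r.num : ℝ) = r * r.den := by exact_mod_cast (Rat.mul_den_eq_num r).symm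
  have h2 : (s.num : ℝ) = s * s.den := by exact_mod_cast (Rat.mul_den_eq_num s).symm
  have h3 : ((s : ℝ) - r) * (s.den * r.den) = ((s.num * r.den - r.num * s.den : ℤ) : ℝ) := by
    push_cast
    rw [h1, h2]; ring
  have h4 : 1 ≤ ((s : ℝ) - r) * (s.den * r.den) := by
    have h5 : (0 : ℝ) < ((s.num * r.den - r.num * s.den : ℤ) : ℝ) := by rw [← h3]; positivity
    rw [h3]
    have h6 : 0 < s.num * r.den - r.num * s.den := by exact_mod_cast h5
    exact_mod_cast h6
  have hr' : (r.den : ℝ) ≤ Q := by exact_mod_cast hr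
  have hs' : (s.den : ℝ) ≤ Q := by exact_mod_cast hs
  calc (1 : ℝ) ≤ ((s : ℝ) - r) * (s.den * r.den) := h4
    _ ≤ ((s : ℝ) - r) * (Q * Q) := by gcongr
    _ = _ := by ring

theorem four_mul_lt_sub {r s : ℚ} (hε : 4 * ε * (Q : ℝ) ^ 2 < 1) (hr : r.den ≤ Q)
    (hs : s.den ≤ Q) (h : r < s) : 4 * ε < (s : ℝ) - r := by
  have h1 := gap_of_den_le hr hs h
  exact lt_of_mul_lt_mul_right (hε.trans_le h1) (by positivity)

/-- The next rational of denominator at most `Q` is more than `4ε` away, so the gap between the two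
`ε`-neighbourhoods contains `(r + ε, r + 3ε)`. The constants `5/4` and `7/4` put a closed strip
strictly inside it. -/
theorem isTwistOn_right (F : PerturbedTwist Q X₁ X₂ ε) (hε0 : 0 < ε)
    (hε : 4 * ε * (Q : ℝ) ^ 2 < 1) {r : ℚ} (hr : r.den ≤ Q) :
    IsTwistOn F (r + 5 / 4 * ε) (r + 7 / 4 * ε) := by
  intro z h1 h2
  refine F.agrees z fun s hs => ?_
  rcases le_or_gt s r with h | h
  · have : (s : ℝ) ≤ r := by exact_mod_cast h
    exact lt_of_lt_of_le (by linarith) (le_abs_self _)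
  · have := four_mul_lt_sub hε hr hs h
    exact lt_of_lt_of_le (by linarith) (neg_le_abs _)

/-- The actual orbits lie within `ε` of their rationals, so the strip separates them exactly as `r`
separates the labels, with `r` itself on the left. -/
theorem pt_side (F : PerturbedTwist Q X₁ X₂ ε) (hε0 : 0 < ε)
    (hε : 4 * ε * (Q : ℝ) ^ 2 < 1) {r : ℚ} (hr : r.den ≤ Q) {γ : OrbitLabel}
    (hγ : (γ.2 : ℝ) ∈ Icc X₁ X₂) (hγQ : γ.2.den ≤ Q) :
    (γ.2 ≤ r ∧ (F.pt γ).1 < r + 5 / 4 * ε) ∨ (r < γ.2 ∧ r + 7 / 4 * ε < (F.pt γ).1) := by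
  have h1 := abs_le.1 (F.pt_near γ.1 γ.2 hγ hγQ)
  rcases le_or_gt γ.2 r with h | h
  · have h2 : (γ.2 : ℝ) ≤ r := by exact_mod_cast h
    exact .inl ⟨h, by linarith [h1.2]⟩
  · have := four_mul_lt_sub hε hr hγQ h
    exact .inr ⟨h, by linarith [h1.1]⟩

/-- The weights in the flux inequality, compared with the support function. -/
theorem weight_bounds (F : PerturbedTwist Q X₁ X₂ ε) (hε0 : 0 < ε)
    (hε : 4 * ε * (Q : ℝ) ^ 2 < 1) {r : ℚ} (hr : r.den ≤ Q) {c : ℝ}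
    (hc : c ∈ Icc (r + 5 / 4 * ε) (r + 7 / 4 * ε)) {γ : OrbitLabel}
    (hγ : (γ.2 : ℝ) ∈ Icc X₁ X₂) (hγQ : γ.2.den ≤ Q) :
    (if (F.pt γ).1 < r + 5 / 4 * ε then (γ.2.num : ℝ) - c * γ.2.den else 0) ≤
      ((γ.2.num : ℝ) - r * γ.2.den) - max 0 ((γ.2.num : ℝ) - r * γ.2.den) ∧
    ((γ.2.num : ℝ) - r * γ.2.den) - max 0 ((γ.2.num : ℝ) - r * γ.2.den) ≤
      (if (F.pt γ).1 < r + 5 / 4 * ε then (γ.2.num : ℝ) - c * γ.2.den else 0) +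
        2 * ε * γ.2.den := by
  have hd : (0 : ℝ) < γ.2.den := by exact_mod_cast γ.2.den_pos
  rcases pt_side F hε0 hε hr hγ hγQ with ⟨h1, h2⟩ | ⟨h1, h2⟩
  · have h3 : (γ.2 : ℝ) ≤ r := by exact_mod_cast h1
    rw [if_pos h2, max_eq_left (by
      rw [num_sub_mul_den]
      exact mul_nonpos_of_nonneg_of_nonpos hd.le (by linarith))]
    constructor <;> nlinarith [hc.1, hc.2]
  · have h3 : (r : ℝ) < γ.2 := by exact_mod_cast h1
    rw [if_neg (by linarith), max_eq_right (by
      rw [num_sub_mul_den]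
      exact mul_nonneg hd.le (by linarith))]
    constructor
    · simp
    · rw [sub_self]; positivity

end CylTwist

theorem proposition3p8 (Q : ℕ) (hQ : 0 < Q) :
    ∃ ε₀ : ℝ, 0 < ε₀ ∧ ∀ ε : ℝ, 0 < ε → ε < ε₀ →
      ∀ (P : ℤ) (X₁ X₂ : ℝ), X₁ ≤ X₂ →
        (∀ r : ℚ, r.den ≤ Q → (r : ℝ) ≠ X₁ ∧ (r : ℝ) ≠ X₂) →
        ∀ (F : CylTwist.PerturbedTwist Q X₁ X₂ ε) (J : CylTwist.AdmissibleJ F)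
          (α β : Multiset CylTwist.OrbitLabel),
          CylTwist.IsGenerator X₁ X₂ P Q α → CylTwist.IsGenerator X₁ X₂ P Q β →
          CylTwist.CrossesRight α β →
          ∀ (S : Type*) [TopologicalSpace S] [T2Space S] [CompactSpace S] [ChartedSpace ℂ S]
            [IsManifold (modelWithCornersSelf ℂ ℂ) ω S],
            IsEmpty (CylTwist.FlowLine F J α β S) := by
  have hQ0 : (0 : ℝ) < Q := by exact_mod_cast hQ
  -- This bound serves twice: it keeps the rationals of denominator at most `Q` more than `4ε`
  -- apart, and it makes the final error `2εQ²` less than `1/2`.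
  refine ⟨1 / (4 * (Q : ℝ) ^ 2), by positivity, ?_⟩
  intro ε hε0 hε1 P X₁ X₂ _ _ F J α β hα hβ hcross S _ _ _ _ _
  refine ⟨fun C => ?_⟩
  have hε : 4 * ε * (Q : ℝ) ^ 2 < 1 := by
    rw [lt_div_iff₀ (by positivity)] at hε1
    linarith
  obtain ⟨γ₀, hγ₀, hgap⟩ := hcross.exists_supportVal_gap
  set r : ℚ := γ₀.2 with hr
  have hrQ : r.den ≤ Q := hβ.den_le hγ₀
  have hlab : ∀ γ, γ ∈ α ∨ γ ∈ β → (γ.2 : ℝ) ∈ Icc X₁ X₂ ∧ γ.2.den ≤ Q := fun γ hγ =>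
    hγ.elim (fun h => ⟨hα.mem_Icc γ h, hα.den_le h⟩) fun h => ⟨hβ.mem_Icc γ h, hβ.den_le h⟩
  obtain ⟨c, hc, hflux⟩ := C.exists_flux_le (by linarith)
    (CylTwist.isTwistOn_right F hε0 hε hrQ)
    (fun γ hγ => (CylTwist.pt_side F hε0 hε hrQ (hlab γ hγ).1 (hlab γ hγ).2).imp And.right
      And.right)
    (fun γ hγ => F.pt_periodic γ.1 γ.2 (hlab γ hγ).1 (hlab γ hγ).2)
  have hupper := Multiset.sum_map_le_sum_map (s := α) _ _ fun γ hγ =>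
    (CylTwist.weight_bounds F hε0 hε hrQ hc (hlab γ (.inl hγ)).1 (hlab γ (.inl hγ)).2).1
  have hlower := Multiset.sum_map_le_sum_map (s := β) _ _ fun γ hγ =>
    (CylTwist.weight_bounds F hε0 hε hrQ hc (hlab γ (.inr hγ)).1 (hlab γ (.inr hγ)).2).2
  rw [Multiset.sum_map_sub, hα.sum_num_sub] at hupper
  rw [Multiset.sum_map_sub, hβ.sum_num_sub, Multiset.sum_map_add, Multiset.sum_map_mul_left,
    hβ.cast_sum_den] at hlower
  -- Up to the error from `c ≠ r`, each weighted sum in the flux inequality is the total `P - rQ`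
  -- minus a support value. The total is common to `α` and `β` and cancels. After multiplication by
  -- the denominator of `r` the bound contradicts the gap of `1`.
  have hdiff : CylTwist.supportVal α r - CylTwist.supportVal β r ≤ 2 * ε * Q := by
    unfold CylTwist.supportVal
    linarith
  have hrd : (0 : ℝ) < r.den := by exact_mod_cast r.den_pos
  have hrQ' : (r.den : ℝ) ≤ Q := by exact_mod_cast hrQ
  have h1 : (CylTwist.supportVal α r - CylTwist.supportVal β r) * r.den ≤ 2 * ε * Q * Q := by
    calc _ ≤ 2 * ε * Q * r.den := by gcongr
      _ ≤ _ := by gcongr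
  nlinarith
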